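/- Let $n\ge 1$, let $q_0,\dots,q_n\in\mathbb{R}^n$ be the vertices of a simplex with sides of unit length, let $F_i(x)=\frac12(x+q_i)$, and let $S_n$ be the Sierpinski $n$-gasket, the unique nonempty compact set with $S_n=\bigcup_i F_i(S_n)$. For a finite word $w=w_1\cdots w_m$ over $\{0,\dots,n\}$ put $|w|=m$, $F_w=F_{w_1}\circ\cdots\circ F_{w_m}$ and $[w]=F_w(S_n)$ (a cell); its boundary points are $F_w(q_0),\dots,F_w(q_n)$. Let $\mu_n$ be the self-similar probability measure on $S_n$ with equal weights, $\mu_n=\frac1{n+1}\sum_i\mu_n\circ F_i^{-1}$, and let $\nu_n$ be the pushforward of $\mu_n$ under the barycentric coordinate $x\mapsto [x]_0$ of $q_0$, a Borel probability measure on $[0,1]$. The length of a path $\gamma:[0,1]\to S_n$ is $|\gamma|=\mathcal{H}^1(\gamma([0,1]))$, the intrinsic distance $d(x,y)$ is the infimum of the lengths of paths in $S_n$ from $x$ to $y$, and a geodesic is a path from $x$ to $y$ of length $d(x,y)$, parametrized at constant speed. Let $A=[w]$ be a cell, let $b\in S_n\setminus A$, and let $\dot a$ be a boundary point of $A$. Suppose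 that every geodesic from a point of $A$ to $b$ passes through $\dot a$ (endpoints included), and that there is a unique geodesic $\hat\gamma$ from $\dot a$ to $b$. For $a\in A$ let $\hat\gamma_{a\to b}$ be a geodesic from $a$ to $b$ that includes $\hat\gamma$, so that $\hat\gamma([0,1])=\hat\gamma_{a\to b}([t_1(a),1])$ for an entry time $t_1(a)$; let $t_1^f=\sup_{a\in A}t_1(a)$ and $Z_t(a,b)=\hat\gamma_{a\to b}(t)$. For $t\in[t_1^f,1]$ the set $Z_t(A,b)=\{Z_t(a,b):a\in A\}$ equals $\hat\gamma(I_t)$ for an interval $I_t\subseteq[0,1]$; let $H_t$ be the increasing affine surjection of $[0,1]$ onto $I_t$ (constant if $I_t$ is a point) followed by $\hat\gamma$. Let $\eta_t(X)=\mu_n(\{a\in A: Z_t(a,b)\in X\})$ for Borel sets $X$. Then for every $t\in[t_1^f,1]$ $$\eta_t=(n+1)^{-|w|}\,\nu_n\circ H_t^{-1}.$$ If $n\ge2$, then for every $t\in[t_1^f,1]$ the measure $\eta_t$ is singular with respect to arc length on $\hat\gamma$ (the restriction of $\mathcal{H}^1$ to $\hat\gamma$). Moreover, for every $t\in[t_1^f,1)$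 the Hausdorff dimension of $\eta_t$, that is $\inf\{\dim_{\mathrm H}E: E\text{ Borel},\ \eta_t(E)>0\}$, equals that of $\nu_n$, namely $$\frac{(n+1)\log(n+1)-n\log n}{(n+1)\log 2}.$$ -/

import Mathlib

open Set MeasureTheory
open scoped ENNReal unitInterval

namespace Gasket

noncomputable section

/-- Euclidean `n`-space. -/
abbrev E (n : ℕ) : Type := EuclideanSpace ℝ (Fin n)

/-- The vertices `q 0, …, q n` span an `n`-simplex all of whose sides have length `1`. -/
def IsUnitSimplex {n : ℕ} (q : AffineBasis (Fin (n + 1)) ℝ (E n)) : Prop :=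
  ∀ i j, i ≠ j → dist (q i) (q j) = 1

/-- The contraction `F_i (x) = (x + q_i) / 2`. -/
def F {n : ℕ} (q : AffineBasis (Fin (n + 1)) ℝ (E n)) (i : Fin (n + 1)) (x : E n) : E n :=
  (1 / 2 : ℝ) • (x + q i)

/-- `F_w = F_{w_1} ∘ ⋯ ∘ F_{w_m}` for a finite word `w = w_1 ⋯ w_m`. -/
def wordMap {n : ℕ} (q : AffineBasis (Fin (n + 1)) ℝ (E n)) (w : List (Fin (n + 1)))
    (x : E n) : E n :=
  w.foldr (fun i y => F q i y) x

/-- The point with infinite address `w_1 w_2 ⋯` (letters indexed from `0` here):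
the limit `∑ 2^{-j} q_{w_j}` of `F_{w_1} ∘ ⋯ ∘ F_{w_m}`. -/
def address {n : ℕ} (q : AffineBasis (Fin (n + 1)) ℝ (E n)) (w : ℕ → Fin (n + 1)) : E n :=
  ∑' j, (1 / 2 : ℝ) ^ (j + 1) • q (w j)

/-- The Sierpinski gasket `S_n`, as the set of points having an address. It is the unique nonempty
compact attractor of the `F_i`: see `gasket_nonempty`, `isCompact_gasket`, `gasket_eq_iUnion` and
`eq_gasket` below. -/
def gasket {n : ℕ} (q : AffineBasis (Fin (n + 1)) ℝ (E n)) : Set (E n) :=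
  range (address q)

/-- The cell `[w] = F_w (S_n)`. -/
def cell {n : ℕ} (q : AffineBasis (Fin (n + 1)) ℝ (E n)) (w : List (Fin (n + 1))) : Set (E n) :=
  wordMap q w '' gasket q

/-- The boundary point of the cell `[w]` with address `w i i i ⋯`. -/
def cellVertex {n : ℕ} (q : AffineBasis (Fin (n + 1)) ℝ (E n)) (w : List (Fin (n + 1)))
    (i : Fin (n + 1)) : E n :=
  wordMap q w (q i)

/-- The standard self-similar measure `μ_n` on `S_n` with all weights `1 / (n + 1)`, as a measure
on the ambient space: the law of the point whose address has independent uniformly distributed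
letters. See `stdMeasure_selfSimilar` for the self-similar identity. -/
def stdMeasure {n : ℕ} (q : AffineBasis (Fin (n + 1)) ℝ (E n)) : Measure (E n) :=
  (Measure.infinitePi fun _ : ℕ =>
    ProbabilityTheory.uniformOn (univ : Set (Fin (n + 1)))).map (address q)

/-- The pushforward `ν_n` of `μ_n` under the barycentric coordinate `x ↦ [x]_0`, as a measure on
the line (it is carried by `[0, 1]`). -/
def nu {n : ℕ} (q : AffineBasis (Fin (n + 1)) ℝ (E n)) : Measure ℝ :=
  (stdMeasure q).map (q.coord 0)

/-- The length `H¹(γ([0, 1]))` of a path. -/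
def pathLength {n : ℕ} {x y : E n} (γ : Path x y) : ℝ≥0∞ :=
  Measure.hausdorffMeasure 1 (range γ)

/-- The intrinsic metric of `S_n`: the infimum of the lengths of paths in `S_n` from `x` to `y`. -/
def intrinsicDist {n : ℕ} (q : AffineBasis (Fin (n + 1)) ℝ (E n)) (x y : E n) : ℝ≥0∞ :=
  ⨅ (γ : Path x y) (_ : range γ ⊆ gasket q), pathLength γ

/-- A geodesic of `S_n`: a path in `S_n` of minimal length, parametrized at constant speed
(`H¹(γ([0, t])) = t |γ|` for all `t`). -/
structure IsGeodesic {n : ℕ} (q : AffineBasis (Fin (n + 1)) ℝ (E n)) {x y : E n}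
    (γ : Path x y) : Prop where
  subset : range γ ⊆ gasket q
  length_eq : pathLength γ = intrinsicDist q x y
  constant_speed : ∀ t : I,
    Measure.hausdorffMeasure 1 (γ '' Icc 0 t) = ENNReal.ofReal t * pathLength γ

/-- `γ = g([t₁, t₂])`: the path `γ` is the part of `g` between the entry time `t₁` and the
exit time `t₂`. -/
def IsPart {n : ℕ} {x y a b : E n} (γ : Path x y) (g : Path a b) (t₁ t₂ : I) : Prop :=
  t₁ ≤ t₂ ∧ g '' Icc t₁ t₂ = range γ

/-- The set of entry times of the common path `γ` from `A` to `B`. -/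
def entryTimes {n : ℕ} (q : AffineBasis (Fin (n + 1)) ℝ (E n)) {x y : E n} (γ : Path x y)
    (A B : Set (E n)) : Set ℝ :=
  {s | ∃ a ∈ A, ∃ b ∈ B, ∃ g : Path a b, IsGeodesic q g ∧
    ∃ t₁ t₂ : I, IsPart γ g t₁ t₂ ∧ s = t₁}

/-- The final entry time `t_1^f`. -/
def finalEntryTime {n : ℕ} (q : AffineBasis (Fin (n + 1)) ℝ (E n)) {x y : E n} (γ : Path x y)
    (A B : Set (E n)) : ℝ :=
  sSup (entryTimes q γ A B)

open Classical in
/-- The interpolant `Z_t(a, b)`: the point at time `t` of a geodesic from `a` to `b` that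
includes the common path `γ` (with the irrelevant value `a` if there is none). -/
def Z {n : ℕ} (q : AffineBasis (Fin (n + 1)) ℝ (E n)) {x y : E n} (γ : Path x y) (t : I)
    (a b : E n) : E n :=
  if h : ∃ g : Path a b, IsGeodesic q g ∧ ∃ t₁ t₂ : I, IsPart γ g t₁ t₂ then h.choose t else a

/-- The interval `I_t ⊆ [0, 1]` with `Z_t(A, b) = γ(I_t)`. -/
def interpInterval {n : ℕ} (q : AffineBasis (Fin (n + 1)) ℝ (E n)) {x y : E n} (γ : Path x y)
    (t : I) (A : Set (E n)) (b : E n) : Set ℝ :=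
  {s | ∃ r : I, s = r ∧ γ r ∈ (fun a => Z q γ t a b) '' A}

/-- The parametrization `H_t` of `Z_t(A, b)`: the increasing linear surjection of `[0, 1]` onto
the interval `I_t`, followed by `γ`. -/
def H {n : ℕ} (q : AffineBasis (Fin (n + 1)) ℝ (E n)) {x y : E n} (γ : Path x y)
    (t : I) (A : Set (E n)) (b : E n) (u : ℝ) : E n :=
  γ.extend (sInf (interpInterval q γ t A b) +
    u * (sSup (interpInterval q γ t A b) - sInf (interpInterval q γ t A b)))

/-- The measure `η_t(X) = μ_n {a ∈ A | Z_t(a, b) ∈ X}`. -/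
def eta {n : ℕ} (q : AffineBasis (Fin (n + 1)) ℝ (E n)) {x y : E n} (γ : Path x y)
    (t : I) (A : Set (E n)) (b : E n) : Measure (E n) :=
  ((stdMeasure q).restrict A).map fun a => Z q γ t a b

/-- Arc length on a path: one-dimensional Hausdorff measure restricted to it. -/
def arcLength {n : ℕ} {x y : E n} (γ : Path x y) : Measure (E n) :=
  (Measure.hausdorffMeasure 1).restrict (range γ)

/-- The Hausdorff dimension `inf {dim_H S | μ S > 0}` of a Borel measure `μ`. -/
def measureDim {X : Type*} [EMetricSpace X] [MeasurableSpace X] (μ : Measure X) : ℝ≥0∞ :=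
  ⨅ (S : Set X) (_ : MeasurableSet S) (_ : 0 < μ S), dimH S

/-! ### The gasket is the attractor and the standard measure is self-similar -/

section Facts

variable {n : ℕ} (q : AffineBasis (Fin (n + 1)) ℝ (E n))

/-- Prepend a letter to an infinite address. -/
def consAddr {α : Type*} (i : α) (w : ℕ → α) : ℕ → α
  | 0 => i
  | k + 1 => w k

theorem exists_bound_q : ∃ C, ∀ i, ‖q i‖ ≤ C :=
  ⟨∑ i, ‖q i‖, fun i => Finset.single_le_sum (f := fun i => ‖q i‖)
    (fun _ _ => norm_nonneg _) (Finset.mem_univ i)⟩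

theorem norm_term_le {C : ℝ} (hC : ∀ i, ‖q i‖ ≤ C) (w : ℕ → Fin (n + 1)) (j : ℕ) :
    ‖(1 / 2 : ℝ) ^ (j + 1) • q (w j)‖ ≤ (1 / 2 : ℝ) ^ j * C := by
  rw [norm_smul]
  have h1 : ‖(1 / 2 : ℝ) ^ (j + 1)‖ ≤ (1 / 2 : ℝ) ^ j := by
    rw [Real.norm_of_nonneg (by positivity), pow_succ]
    nlinarith [pow_pos (show (0 : ℝ) < 1 / 2 by norm_num) j]
  exact mul_le_mul h1 (hC _) (norm_nonneg _) (by positivity)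

theorem summable_bound (C : ℝ) : Summable fun j : ℕ => (1 / 2 : ℝ) ^ j * C :=
  (summable_geometric_of_lt_one (by norm_num) (by norm_num)).mul_right C

theorem summable_address (w : ℕ → Fin (n + 1)) :
    Summable fun j => (1 / 2 : ℝ) ^ (j + 1) • q (w j) := by
  obtain ⟨C, hC⟩ := exists_bound_q q
  exact Summable.of_norm_bounded (summable_bound C) (norm_term_le q hC w)

theorem continuous_address : Continuous (address q) := by
  obtain ⟨C, hC⟩ := exists_bound_q q
  refine continuous_tsum (fun j => ?_) (summable_bound C) (fun j w => norm_term_le q hC w j)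
  have h : Continuous fun i => q i := continuous_of_discreteTopology
  have h' : Continuous fun w : ℕ → Fin (n + 1) => q (w j) := h.comp (continuous_apply j)
  exact h'.const_smul ((1 / 2 : ℝ) ^ (j + 1))

theorem address_consAddr (i : Fin (n + 1)) (w : ℕ → Fin (n + 1)) :
    address q (consAddr i w) = F q i (address q w) := by
  unfold address F
  rw [(summable_address q (consAddr i w)).tsum_eq_zero_add, smul_add,
    ← (summable_address q w).tsum_const_smul, add_comm]
  congr 1
  · refine tsum_congr fun j => ?_
    rw [smul_smul]
    congr 1
    ring
  · simp [consAddr]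

theorem gasket_nonempty : (gasket q).Nonempty := range_nonempty _

theorem isCompact_gasket : IsCompact (gasket q) := isCompact_range (continuous_address q)

theorem gasket_eq_iUnion : gasket q = ⋃ i, F q i '' gasket q := by
  ext x
  simp only [gasket, mem_range, mem_iUnion, mem_image, exists_exists_eq_and]
  constructor
  · rintro ⟨w, rfl⟩
    refine ⟨w 0, fun k => w (k + 1), ?_⟩
    rw [← address_consAddr]
    congr 1
    funext k
    cases k <;> rfl
  · rintro ⟨i, w, rfl⟩
    exact ⟨consAddr i w, address_consAddr q i w⟩

theorem subset_of_invariant {K L : Set (E n)} (hK : IsCompact K) (hK0 : K.Nonempty)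
    (hKF : K ⊆ ⋃ i, F q i '' K) (hL : IsClosed L) (hL0 : L.Nonempty)
    (hLF : ⋃ i, F q i '' L ⊆ L) : K ⊆ L := by
  obtain ⟨x, hx, hmax⟩ := hK.exists_isMaxOn hK0
    (Metric.continuous_infDist_pt L).continuousOn
  obtain ⟨i, y, hy, hyx⟩ := mem_iUnion.1 (hKF hx)
  have h1 : Metric.infDist x L ≤ (1 / 2) * Metric.infDist y L := by
    rw [← div_le_iff₀' (by norm_num)]
    refine (Metric.le_infDist hL0).2 fun z hz => ?_
    have hz' : F q i z ∈ L := hLF (mem_iUnion.2 ⟨i, mem_image_of_mem _ hz⟩)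
    have h2 := Metric.infDist_le_dist_of_mem (x := x) hz'
    have h3 : dist x (F q i z) = (1 / 2) * dist y z := by
      rw [← hyx, F, F, dist_smul₀, dist_add_right]
      norm_num
    rw [h3] at h2
    rw [div_le_iff₀' (by norm_num)]
    exact h2
  have h2 : Metric.infDist y L ≤ Metric.infDist x L := hmax hy
  have h0 : Metric.infDist x L ≤ 0 := by linarith
  intro z hz
  have hz1 : Metric.infDist z L ≤ Metric.infDist x L := hmax hz
  exact (hL.mem_iff_infDist_zero hL0).2 (le_antisymm (hz1.trans h0) Metric.infDist_nonneg)

theorem eq_gasket {K : Set (E n)} (hK : IsCompact K) (hK0 : K.Nonempty)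
    (hKF : K = ⋃ i, F q i '' K) : K = gasket q :=
  Subset.antisymm
    (subset_of_invariant q hK hK0 hKF.subset (isCompact_gasket q).isClosed (gasket_nonempty q)
      (gasket_eq_iUnion q).symm.subset)
    (subset_of_invariant q (isCompact_gasket q) (gasket_nonempty q) (gasket_eq_iUnion q).subset
      hK.isClosed hK0 hKF.symm.subset)

theorem isProbabilityMeasure_stdMeasure : IsProbabilityMeasure (stdMeasure q) :=
  Measure.isProbabilityMeasure_map (continuous_address q).measurable.aemeasurable

theorem stdMeasure_gasket : stdMeasure q (gasket q) = 1 := by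
  rw [stdMeasure, Measure.map_apply (continuous_address q).measurable
    (isCompact_gasket q).isClosed.measurableSet]
  have : address q ⁻¹' gasket q = univ := eq_univ_of_forall fun w => mem_range_self w
  rw [this, measure_univ]

theorem measurable_consAddr (i : Fin (n + 1)) :
    Measurable (consAddr i : (ℕ → Fin (n + 1)) → ℕ → Fin (n + 1)) := by
  refine measurable_pi_iff.2 fun k => ?_
  cases k with
  | zero => exact measurable_const
  | succ k => exact measurable_pi_apply k

theorem uniformOn_eq_sum (n : ℕ) (s : Set (Fin (n + 1))) :
    ProbabilityTheory.uniformOn univ s = ∑ i, ((n : ℝ≥0∞) + 1)⁻¹ * s.indicator 1 i := by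
  classical
  rw [← Finset.mul_sum, ProbabilityTheory.uniformOn_univ, ENNReal.div_eq_inv_mul]
  congr 1
  · simp
  · rw [Measure.count_apply (Set.toFinite s).measurableSet,
      ← tsum_fintype (L := SummationFilter.unconditional _),
      ← tsum_subtype s (1 : Fin (n + 1) → ℝ≥0∞)]
    simp [Set.encard_eq_coe_toFinset_card]

theorem infinitePi_eq_sum (n : ℕ) :
    (Measure.infinitePi fun _ : ℕ => ProbabilityTheory.uniformOn (univ : Set (Fin (n + 1)))) =
      ∑ i, ((n : ℝ≥0∞) + 1)⁻¹ • (Measure.infinitePi fun _ : ℕ =>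
        ProbabilityTheory.uniformOn (univ : Set (Fin (n + 1)))).map (consAddr i) := by
  classical
  symm
  refine Measure.eq_infinitePi _ fun s t ht => ?_
  set P : Measure (Fin (n + 1)) := ProbabilityTheory.uniformOn univ with hP
  obtain ⟨N, hN⟩ := s.exists_nat_subset_range
  let t' : ℕ → Set (Fin (n + 1)) := fun k => if k ∈ s then t k else univ
  have ht' : ∀ k, MeasurableSet (t' k) := fun k => (Set.toFinite _).measurableSet
  have hsub : s ⊆ Finset.range (N + 1) :=
    hN.trans (Finset.range_mono (Nat.le_succ N))
  have hpi : Set.pi (s : Set ℕ) t = Set.pi (Finset.range (N + 1) : Set ℕ) t' := by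
    ext w
    simp only [Set.mem_pi, Finset.mem_coe]
    constructor
    · intro h k _
      by_cases hk : k ∈ s
      · simpa [t', hk] using h k hk
      · simp [t', hk]
    · intro h k hk
      simpa [t', hk] using h k (hsub hk)
  have hprod : ∏ k ∈ s, P (t k) = ∏ k ∈ Finset.range (N + 1), P (t' k) := by
    rw [← Finset.prod_subset hsub (f := fun k => P (t' k))]
    · exact Finset.prod_congr rfl fun k hk => by simp [t', hk]
    · intro k _ hk
      simp [t', hk, hP]
  have hmeas : MeasurableSet (Set.pi (Finset.range (N + 1) : Set ℕ) t') :=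
    MeasurableSet.pi (Finset.countable_toSet _) fun k _ => ht' k
  have hterm : ∀ i, (Measure.infinitePi fun _ : ℕ => P).map (consAddr i)
      (Set.pi (Finset.range (N + 1) : Set ℕ) t') =
      (t' 0).indicator 1 i * ∏ k ∈ Finset.range N, P (t' (k + 1)) := by
    intro i
    rw [Measure.map_apply (measurable_consAddr i) hmeas]
    by_cases hi : i ∈ t' 0
    · have : consAddr i ⁻¹' Set.pi (Finset.range (N + 1) : Set ℕ) t' =
          Set.pi (Finset.range N : Set ℕ) fun k => t' (k + 1) := by
        ext w
        simp only [Set.mem_preimage, Set.mem_pi, Finset.mem_coe, Finset.mem_range]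
        constructor
        · intro h k hk
          exact h (k + 1) (by omega)
        · intro h k hk
          cases k with
          | zero => exact hi
          | succ k => exact h k (by omega)
      rw [this, Measure.infinitePi_pi _ fun k _ => ht' (k + 1)]
      simp [hi]
    · have : consAddr i ⁻¹' Set.pi (Finset.range (N + 1) : Set ℕ) t' = ∅ := by
        ext w
        simp only [Set.mem_preimage, Set.mem_pi, Finset.mem_coe, Finset.mem_range,
          Set.mem_empty_iff_false, iff_false]
        exact fun h => hi (h 0 (by omega))
      rw [this]
      simp [hi]
  rw [hpi, hprod, Finset.prod_range_succ', hP, uniformOn_eq_sum n (t' 0), ← hP,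
    Measure.finsetSum_apply, mul_comm, Finset.sum_mul]
  refine Finset.sum_congr rfl fun i _ => ?_
  rw [Measure.smul_apply, hterm, smul_eq_mul, mul_assoc]

/-- The self-similar identity `μ_n(X) = ∑ i, μ_n(F_i⁻¹(X)) / (n + 1)`. -/
theorem stdMeasure_selfSimilar :
    stdMeasure q = ∑ i, ((n : ℝ≥0∞) + 1)⁻¹ • (stdMeasure q).map (F q i) := by
  have hF : ∀ i, Measurable (F q i) := fun i => by unfold F; fun_prop
  have ha := (continuous_address q).measurable
  conv_lhs => rw [stdMeasure, infinitePi_eq_sum]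
  rw [← Measure.mapₗ_apply_of_measurable ha, map_sum]
  refine Finset.sum_congr rfl fun i _ => ?_
  rw [map_smul, Measure.mapₗ_apply_of_measurable ha, Measure.map_map ha (measurable_consAddr i),
    stdMeasure, Measure.map_map (hF i) ha]
  congr 2
  funext w
  exact address_consAddr q i w

end Facts

end

end Gasket

/-! Write `m = |w|`, let `i` be the index of the entry vertex and `L` the intrinsic distance from
this vertex to `b`. The key fact is that a point `F_w(x)` lies at intrinsic distance exactly `2⁻ᵐ (1
- [x]_i)` from the vertex `F_w(q_i)` (`gdist_vertex`). A geodesic from `F_w(x)` to `b` passes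
through that vertex and, by uniqueness, follows `γ` afterwards. Its entry time `s` therefore
satisfies `s D = 2⁻ᵐ (1 - [x]_i)` and `(1 - s) D = L`, where `D` is its length. Hence its point at
time `t` is `γ(r)` with `r = (t - s) / (1 - s) = t - (1 - t) 2⁻ᵐ / L · (1 - [x]_i)`, which is affine
in `[x]_i` (`exists_Z_eq`). So `Z_t(F_w(x), b) = H_t([x]_i)`. The restriction of `μ_n` to the cell
is `(n+1)⁻ᵐ` times the image of `μ_n` under `F_w`, and every barycentric coordinate has the law
`ν_n` by symmetry; this gives the formula for `η_t` (`eta_eq`).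

Lengths are Hausdorff measures, and neither `[x]_j` nor the intrinsic distance to a point is
1-Lipschitz for the Euclidean metric in general. The substitute is `ofReal_sub_le_hausdorffMeasure`:
a function that oscillates by at most `2⁻ᵐ` on each cell of level `m` cannot grow along a curve by
more than the length of the curve, because crossing a cell from vertex to vertex costs length at
least `2⁻ᵐ`. Minimizers are produced by compactness of 1-Lipschitz curves (`Join.of_tendsto`).

Under `ν_n` the binary digits are independent and equal to `1` with probability `1/(n+1)`. The law
of large numbers for the logarithms of cylinder probabilities, together with the mass distribution
principle and a covering by cylinders, gives the dimension entropy over `log 2`. For `n ≥ 2` this is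
below `1`, so `ν_n` is carried by a Lebesgue null set, and the Lipschitz map `H_t` carries this set
to an `H¹`-null set. For `t < 1` the map `H_t` scales `[0, 1]` by `(1 - t) 2⁻ᵐ` in the intrinsic
metric, which is bi-Lipschitz equivalent to the Euclidean one (`exists_gdist_le_mul_dist`), so the
dimension is preserved. -/

namespace Gasket

noncomputable section

/-! ### Barycentric coordinates and the contractions. -/

section Coordinates

variable {n : ℕ} (q : AffineBasis (Fin (n + 1)) ℝ (E n))

theorem F_eq_midpoint (i : Fin (n + 1)) (x : E n) : F q i x = midpoint ℝ x (q i) := by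
  rw [F, midpoint_eq_smul_add]
  norm_num

theorem coord_F (k i : Fin (n + 1)) (x : E n) :
    q.coord k (F q i x) = (1 / 2) * (q.coord k x + if k = i then 1 else 0) := by
  rw [F_eq_midpoint, AffineMap.map_midpoint, AffineBasis.coord_apply, midpoint_eq_smul_add]
  norm_num

theorem dist_F (i : Fin (n + 1)) (x y : E n) : dist (F q i x) (F q i y) = (1 / 2) * dist x y := by
  rw [F, F, dist_smul₀, dist_add_right]
  norm_num

theorem F_injective (i : Fin (n + 1)) : Function.Injective (F q i) := fun x y h => by
  have := dist_F q i x y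
  rw [h, dist_self] at this
  exact dist_eq_zero.1 (by linarith)

theorem F_vertex (i : Fin (n + 1)) : F q i (q i) = q i := by
  rw [F_eq_midpoint, midpoint_self]

theorem continuous_F (i : Fin (n + 1)) : Continuous (F q i) := by
  unfold F
  fun_prop

theorem F_mem_gasket (i : Fin (n + 1)) {x : E n} (hx : x ∈ gasket q) : F q i x ∈ gasket q := by
  rw [gasket_eq_iUnion]
  exact mem_iUnion.2 ⟨i, mem_image_of_mem _ hx⟩

theorem continuous_coord (k : Fin (n + 1)) : Continuous (q.coord k) :=
  AffineMap.continuous_of_finiteDimensional _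

theorem vertex_mem_gasket (i : Fin (n + 1)) : q i ∈ gasket q := by
  refine subset_of_invariant q (K := {q i}) isCompact_singleton (singleton_nonempty _) ?_
    (isCompact_gasket q).isClosed (gasket_nonempty q) (gasket_eq_iUnion q).symm.subset rfl
  rintro x rfl
  exact mem_iUnion.2 ⟨i, _, rfl, F_vertex q i⟩

theorem coord_nonneg (k : Fin (n + 1)) {x : E n} (hx : x ∈ gasket q) : 0 ≤ q.coord k x := by
  refine subset_of_invariant q (isCompact_gasket q) (gasket_nonempty q) (gasket_eq_iUnion q).subset
    (L := {x | 0 ≤ q.coord k x}) (isClosed_le continuous_const (continuous_coord q k))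
    ⟨q k, by simp⟩ ?_ hx
  intro x hx
  obtain ⟨i, y, hy, rfl⟩ := mem_iUnion.1 hx
  simp only [mem_ofPred_eq] at hy ⊢
  rw [coord_F]
  split_ifs <;> linarith

theorem coord_le_one (k : Fin (n + 1)) {x : E n} (hx : x ∈ gasket q) : q.coord k x ≤ 1 := by
  rw [← q.sum_coord_apply_eq_one x]
  exact Finset.single_le_sum (f := fun i => q.coord i x) (fun i _ => coord_nonneg q i hx)
    (Finset.mem_univ k)

theorem eq_of_coord_eq {x y : E n} (h : ∀ k, q.coord k x = q.coord k y) : x = y := by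
  rw [← q.affineCombination_coord_eq_self x, ← q.affineCombination_coord_eq_self y]
  congr 1
  funext k
  exact h k

theorem eq_vertex_of_coord_eq_one {k : Fin (n + 1)} {x : E n} (hx : x ∈ gasket q)
    (h : q.coord k x = 1) : x = q k := by
  refine eq_of_coord_eq q fun i => ?_
  rw [AffineBasis.coord_apply]
  split_ifs with hik
  · rw [hik, h]
  · refine le_antisymm ?_ (coord_nonneg q i hx)
    have h1 : q.coord i x + q.coord k x ≤ ∑ j, q.coord j x := by
      rw [← Finset.sum_pair (f := fun j => q.coord j x) hik]
      exact Finset.sum_le_sum_of_subset_of_nonneg (Finset.subset_univ _)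
        fun j _ _ => coord_nonneg q j hx
    rw [q.sum_coord_apply_eq_one] at h1
    linarith

/-- Compare `j`-th coordinates: on the right it is at least `1/2`, on the left it is half of
`[x]_j`, so `[x]_j = 1`. -/
theorem F_eq_F_of_ne {i j : Fin (n + 1)} (hij : i ≠ j) {x y : E n} (hx : x ∈ gasket q)
    (hy : y ∈ gasket q) (h : F q i x = F q j y) : x = q j := by
  have h1 := congrArg (q.coord j) h
  rw [coord_F, coord_F, if_neg hij.symm, if_pos rfl] at h1
  exact eq_vertex_of_coord_eq_one q hx
    (le_antisymm (coord_le_one q j hx) (by linarith [coord_nonneg q j hy]))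

end Coordinates

/-! ### Cells, their vertices and their intersections. -/

section Cells

variable {n : ℕ} (q : AffineBasis (Fin (n + 1)) ℝ (E n))

@[simp] theorem wordMap_nil (x : E n) : wordMap q [] x = x := rfl

@[simp] theorem wordMap_cons (i : Fin (n + 1)) (w : List (Fin (n + 1))) (x : E n) :
    wordMap q (i :: w) x = F q i (wordMap q w x) := rfl

theorem wordMap_mem_gasket (w : List (Fin (n + 1))) {x : E n} (hx : x ∈ gasket q) :
    wordMap q w x ∈ gasket q := by
  induction w with
  | nil => exact hx
  | cons i w ih => exact F_mem_gasket q i ih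

theorem dist_wordMap (w : List (Fin (n + 1))) (x y : E n) :
    dist (wordMap q w x) (wordMap q w y) = (1 / 2) ^ w.length * dist x y := by
  induction w with
  | nil => simp
  | cons i w ih =>
    rw [wordMap_cons, wordMap_cons, dist_F, ih, List.length_cons]
    ring

theorem continuous_wordMap (w : List (Fin (n + 1))) : Continuous (wordMap q w) := by
  induction w with
  | nil => exact continuous_id
  | cons i w ih => exact (continuous_F q i).comp ih

theorem cell_nil : cell q [] = gasket q := image_id _

theorem cell_cons (i : Fin (n + 1)) (w : List (Fin (n + 1))) :
    cell q (i :: w) = F q i '' cell q w := by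
  rw [cell, cell, ← image_comp]
  rfl

theorem isCompact_cell (w : List (Fin (n + 1))) : IsCompact (cell q w) :=
  (isCompact_gasket q).image (continuous_wordMap q w)

theorem cell_subset_gasket (w : List (Fin (n + 1))) : cell q w ⊆ gasket q := by
  rintro _ ⟨x, hx, rfl⟩
  exact wordMap_mem_gasket q w hx

theorem cellVertex_mem_cell (w : List (Fin (n + 1))) (i : Fin (n + 1)) :
    cellVertex q w i ∈ cell q w :=
  mem_image_of_mem _ (vertex_mem_gasket q i)

theorem exists_mem_cell (m : ℕ) {x : E n} (hx : x ∈ gasket q) :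
    ∃ w : List.Vector (Fin (n + 1)) m, x ∈ cell q w.1 := by
  induction m generalizing x with
  | zero => exact ⟨List.Vector.nil, by rwa [show List.Vector.nil.1 = [] from rfl, cell_nil]⟩
  | succ m ih =>
    rw [gasket_eq_iUnion] at hx
    obtain ⟨i, y, hy, rfl⟩ := mem_iUnion.1 hx
    obtain ⟨w, hw⟩ := ih hy
    refine ⟨List.Vector.cons i w, ?_⟩
    rw [show (List.Vector.cons i w).1 = i :: w.1 from rfl, cell_cons]
    exact mem_image_of_mem _ hw

/-- The corners of the simplex are extreme: peeling off one letter at a time, each preimage in the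
gasket of the corner `q k` is again `q k`. -/
theorem eq_vertex_of_wordMap_eq_vertex {k : Fin (n + 1)} (w : List (Fin (n + 1))) {x : E n}
    (hx : x ∈ gasket q) (h : wordMap q w x = q k) : x = q k := by
  induction w with
  | nil => exact h
  | cons i w ih =>
    apply ih
    rw [wordMap_cons] at h
    have hy := wordMap_mem_gasket q w hx
    by_cases hik : i = k
    · subst hik
      exact F_injective q i (h.trans (F_vertex q i).symm)
    · exact F_eq_F_of_ne q hik hy (vertex_mem_gasket q k) (h.trans (F_vertex q k).symm)

/-- Two distinct cells of the same level meet only in vertices. -/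
theorem eq_cellVertex_of_mem_cell_inter {v w : List (Fin (n + 1))} (hlen : v.length = w.length)
    (hvw : v ≠ w) {z : E n} (hv : z ∈ cell q v) (hw : z ∈ cell q w) :
    ∃ k, z = cellVertex q v k := by
  induction v generalizing w z with
  | nil => exact absurd (List.length_eq_zero_iff.1 hlen.symm).symm hvw
  | cons i v ih =>
    cases w with
    | nil => simp at hlen
    | cons j w =>
      rw [cell_cons] at hv hw
      obtain ⟨x, hx, rfl⟩ := hv
      obtain ⟨y, hy, hxy⟩ := hw
      by_cases hij : i = j
      · subst hij
        rw [F_injective q i hxy] at hy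
        obtain ⟨k, rfl⟩ := ih (by simpa using hlen) (fun h => hvw (by rw [h])) hx hy
        exact ⟨k, rfl⟩
      -- The words differ in their first letters, so the meeting point comes from the corner `q j`;
      -- this corner can lie in the cell of the remaining word only as one of its vertices.
      · have h1 := F_eq_F_of_ne q hij (cell_subset_gasket q v hx) (cell_subset_gasket q w hy)
          hxy.symm
        obtain ⟨z, hz, rfl⟩ := hx
        have h2 := eq_vertex_of_wordMap_eq_vertex q v hz h1
        exact ⟨j, by rw [h2]; rfl⟩

/-- The boundary points of the cells of level `m`. -/
def levelVertices (m : ℕ) : Set (E n) :=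
  range fun p : List.Vector (Fin (n + 1)) m × Fin (n + 1) => cellVertex q p.1.1 p.2

theorem finite_levelVertices (m : ℕ) : (levelVertices q m).Finite := finite_range _

theorem exists_eq_cellVertex {m : ℕ} {z : E n} (hz : z ∈ levelVertices q m)
    (w : List.Vector (Fin (n + 1)) m) (hw : z ∈ cell q w.1) : ∃ k, z = cellVertex q w.1 k := by
  obtain ⟨⟨v, k⟩, rfl⟩ := hz
  by_cases hvw : v = w
  · exact ⟨k, by rw [hvw]⟩
  · exact eq_cellVertex_of_mem_cell_inter q (w.2.trans v.2.symm)
      (fun h => hvw (Subtype.ext h.symm)) hw (cellVertex_mem_cell q v.1 k)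

theorem mem_levelVertices_of_mem_inter {m : ℕ} {v w : List.Vector (Fin (n + 1)) m} (hvw : v ≠ w)
    {z : E n} (hv : z ∈ cell q v.1) (hw : z ∈ cell q w.1) : z ∈ levelVertices q m := by
  obtain ⟨k, rfl⟩ := eq_cellVertex_of_mem_cell_inter q (v.2.trans w.2.symm)
    (fun h => hvw (Subtype.ext h)) hv hw
  exact ⟨(v, k), rfl⟩

theorem dist_cellVertex (hq : IsUnitSimplex q) (w : List (Fin (n + 1))) {i j : Fin (n + 1)}
    (hij : i ≠ j) : dist (cellVertex q w i) (cellVertex q w j) = (1 / 2) ^ w.length := by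
  rw [cellVertex, cellVertex, dist_wordMap, hq i j hij, mul_one]

/-- A connected subset of the gasket that avoids the vertices of level `m` lies in a single cell
of level `m`. -/
theorem exists_subset_cell_of_isPreconnected {m : ℕ} {T : Set (E n)} (hT : IsPreconnected T)
    (hTS : T ⊆ gasket q) (hTV : Disjoint T (levelVertices q m)) :
    ∃ w : List.Vector (Fin (n + 1)) m, T ⊆ cell q w.1 := by
  rcases T.eq_empty_or_nonempty with rfl | ⟨x, hx⟩
  · exact ⟨List.Vector.replicate m 0, empty_subset _⟩
  obtain ⟨w, hw⟩ := exists_mem_cell q m (hTS hx)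
  refine ⟨w, fun y hy => ?_⟩
  by_contra hyw
  -- The chosen cell and the union of the other cells form a closed cover of `T`. They meet only in
  -- vertices of level `m`, which `T` avoids, so connectedness forbids `T` to meet both.
  have hD : IsClosed (⋃ v ∈ {v : List.Vector (Fin (n + 1)) m | v ≠ w}, cell q v.1) :=
    (toFinite _).isClosed_biUnion fun v _ => (isCompact_cell q v.1).isClosed
  have hcov : ∀ z ∈ T, z ∉ cell q w.1 →
      z ∈ ⋃ v ∈ {v : List.Vector (Fin (n + 1)) m | v ≠ w}, cell q v.1 := by
    intro z hz hzw
    obtain ⟨v, hv⟩ := exists_mem_cell q m (hTS hz)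
    exact mem_biUnion (show v ≠ w by rintro rfl; exact hzw hv) hv
  obtain ⟨z, hzT, hz1, hz2⟩ := isPreconnected_closed_iff.1 hT _ _ (isCompact_cell q w.1).isClosed hD
    (fun z hz => (em (z ∈ cell q w.1)).imp id (hcov z hz)) ⟨x, hx, hw⟩ ⟨y, hy, hcov y hy hyw⟩
  obtain ⟨v, hvw, hzv⟩ := mem_iUnion₂.1 hz2
  exact hTV.le_bot ⟨hzT, mem_levelVertices_of_mem_inter q hvw hzv hz1⟩

end Cells

/-! ### The standard measure of vertices and cells. -/

section Mass

variable {n : ℕ} (q : AffineBasis (Fin (n + 1)) ℝ (E n))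

theorem stdMeasure_compl_gasket : stdMeasure q (gasket q)ᶜ = 0 := by
  have := isProbabilityMeasure_stdMeasure q
  rw [measure_compl (isCompact_gasket q).isClosed.measurableSet (measure_ne_top _ _),
    stdMeasure_gasket, measure_univ, tsub_self]

theorem stdMeasure_apply {X : Set (E n)} (hX : MeasurableSet X) :
    stdMeasure q X = ∑ i, ((n : ℝ≥0∞) + 1)⁻¹ * stdMeasure q (F q i ⁻¹' X) := by
  conv_lhs => rw [stdMeasure_selfSimilar]
  rw [Measure.finsetSum_apply]
  refine Finset.sum_congr rfl fun i _ => ?_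
  rw [Measure.smul_apply, Measure.map_apply (continuous_F q i).measurable hX, smul_eq_mul]

/-- Among the maps only `F k` reaches `q k` from the gasket, so self-similarity makes the mass `p`
of the vertex satisfy `p = p / (n + 1)`. -/
theorem stdMeasure_vertex (hn : 1 ≤ n) (k : Fin (n + 1)) : stdMeasure q {q k} = 0 := by
  have := isProbabilityMeasure_stdMeasure q
  have h := stdMeasure_apply q (measurableSet_singleton (q k))
  rw [Finset.sum_eq_single k] at h
  · have h1 : F q k ⁻¹' {q k} = {q k} := by
      ext x
      simp only [mem_preimage, mem_singleton_iff]
      refine ⟨fun hx => F_injective q k (hx.trans (F_vertex q k).symm), ?_⟩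
      rintro rfl
      exact F_vertex q k
    rw [h1] at h
    by_contra h0
    have h2 : ((n : ℝ≥0∞) + 1)⁻¹ = 1 := by
      have h3 := congrArg (· / stdMeasure q {q k}) h
      simp only [mul_div_assoc, ENNReal.div_self h0 (measure_ne_top _ _), mul_one] at h3
      exact h3.symm
    rw [ENNReal.inv_eq_one] at h2
    have h3 : n + 1 = 1 := by exact_mod_cast h2
    omega
  · intro j _ hjk
    have h1 : F q j ⁻¹' {q k} ⊆ (gasket q)ᶜ ∪ {q k} := by
      intro x hx
      by_cases hxS : x ∈ gasket q
      · exact Or.inr (F_eq_F_of_ne q hjk hxS (vertex_mem_gasket q k)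
          ((mem_singleton_iff.1 hx).trans (F_vertex q k).symm))
      · exact Or.inl hxS
    have h2 : F q j ⁻¹' {q k} ⊆ (gasket q)ᶜ := by
      intro x hx
      rcases h1 hx with h | h
      · exact h
      · exfalso
        rw [mem_singleton_iff.1 h] at hx
        have := congrArg (q.coord k) (mem_singleton_iff.1 hx)
        rw [coord_F, if_neg (Ne.symm hjk)] at this
        simp at this
    rw [measure_mono_null h2 (stdMeasure_compl_gasket q), mul_zero]
  · simp

/-- The standard measure on a cell is a scaled copy of the standard measure. -/
theorem stdMeasure_restrict_cell (hn : 1 ≤ n) (w : List (Fin (n + 1))) :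
    (stdMeasure q).restrict (cell q w) =
      (((n : ℝ≥0∞) + 1)⁻¹ ^ w.length) • (stdMeasure q).map (wordMap q w) := by
  induction w with
  | nil =>
    rw [cell_nil, List.length_nil, pow_zero, one_smul, Measure.restrict_eq_self_of_ae_mem]
    · exact Measure.map_id.symm
    · exact stdMeasure_compl_gasket q
  | cons i w ih =>
    ext X hX
    have hFX : MeasurableSet (F q i ⁻¹' X) := (continuous_F q i).measurable hX
    rw [Measure.restrict_apply hX, stdMeasure_apply q
      (hX.inter (isCompact_cell q _).isClosed.measurableSet), Finset.sum_eq_single i]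
    · have h1 : F q i ⁻¹' (X ∩ cell q (i :: w)) = F q i ⁻¹' X ∩ cell q w := by
        rw [preimage_inter, cell_cons, preimage_image_eq _ (F_injective q i)]
      rw [h1, ← Measure.restrict_apply hFX, ih, Measure.smul_apply, Measure.smul_apply,
        Measure.map_apply (continuous_wordMap q w).measurable hFX,
        Measure.map_apply (continuous_wordMap q _).measurable hX, List.length_cons, pow_succ',
        smul_eq_mul, smul_eq_mul, mul_assoc]
      rfl
    · intro j _ hji
      -- A map with another first letter reaches this cell only from outside the gasket or from the
      -- single point `q i`, both of measure zero.
      have h1 : F q j ⁻¹' (X ∩ cell q (i :: w)) ⊆ (gasket q)ᶜ ∪ {q i} := by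
        rintro x ⟨-, hx⟩
        rw [cell_cons] at hx
        obtain ⟨y, hy, hyx⟩ := hx
        by_cases hxS : x ∈ gasket q
        · exact Or.inr (F_eq_F_of_ne q hji hxS (cell_subset_gasket q w hy) hyx.symm)
        · exact Or.inl hxS
      rw [measure_mono_null h1 (measure_union_null (stdMeasure_compl_gasket q)
        (stdMeasure_vertex q hn i)), mul_zero]
    · simp

end Mass

/-! ### Lower bounds for the length of curves in the gasket. -/

section LowerBound

/-- The distance to `x` is 1-Lipschitz and maps the connected set onto a set containing `[0, dist x
y]`. -/
theorem ofReal_dist_le_hausdorffMeasure {X : Type*} [MetricSpace X] [MeasurableSpace X]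
    [BorelSpace X] {T : Set X} (hT : IsPreconnected T) {x y : X} (hx : x ∈ T) (hy : y ∈ T) :
    ENNReal.ofReal (dist x y) ≤ Measure.hausdorffMeasure 1 T := by
  have hL : LipschitzWith 1 (dist x) := LipschitzWith.dist_right x
  have h1 := hL.lipschitzOnWith (s := T) |>.hausdorffMeasure_image_le (d := 1) zero_le_one
  have h2 : Icc 0 (dist x y) ⊆ dist x '' T := by
    have := (hT.image _ hL.continuous.continuousOn).Icc_subset (mem_image_of_mem _ hx)
      (mem_image_of_mem _ hy)
    rwa [dist_self] at this
  have h3 := measure_mono (μ := volume) h2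
  rw [Real.volume_Icc, sub_zero, ← hausdorffMeasure_real] at h3
  simpa using h3.trans h1

variable {n : ℕ} (q : AffineBasis (Fin (n + 1)) ℝ (E n))

/-- A curve that runs between two points of the gasket crosses, between two consecutive vertices
of level `m`, a single cell. -/
theorem exists_crossing (m : ℕ) {g : ℝ → E n} (hg : Continuous g) (hgS : ∀ t, g t ∈ gasket q)
    {a b : ℝ} (hab : a ≤ b) (f : E n → ℝ) {r : ℝ} (hr : r ∈ Ioo (f (g a)) (f (g b)))
    (hrV : r ∉ f '' levelVertices q m) :
    ∃ s₁ s₂, a ≤ s₁ ∧ s₁ ≤ s₂ ∧ s₂ ≤ b ∧ f (g s₁) < r ∧ r < f (g s₂) ∧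
      (s₁ = a ∨ g s₁ ∈ levelVertices q m) ∧ (s₂ = b ∨ g s₂ ∈ levelVertices q m) ∧
      ∃ w : List.Vector (Fin (n + 1)) m, g '' Icc s₁ s₂ ⊆ cell q w.1 := by
  have hcl : ∀ V ⊆ levelVertices q m, IsClosed (g ⁻¹' V) := fun V hV =>
    ((finite_levelVertices q m).subset hV).isClosed.preimage hg
  -- The time `s₁` is the last visit to a vertex where `f < r`, and `s₂` below is the first later
  -- visit to a vertex where `f > r`. Adjoining `a` and `b` supplies a value when there is no such
  -- visit.
  obtain ⟨s₁, h1, h1max⟩ := IsCompact.exists_isGreatest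
    (isCompact_singleton.union (isCompact_Icc.inter_right
      (hcl {z ∈ levelVertices q m | f z < r} fun z hz => hz.1))) ⟨a, Or.inl (mem_singleton a)⟩
      (s := {a} ∪ (Icc a b ∩ g ⁻¹' {z ∈ levelVertices q m | f z < r}))
  have has₁ : a ≤ s₁ := h1max (Or.inl rfl)
  have hs₁b : s₁ ≤ b := by
    rcases h1 with h | h
    · rw [mem_singleton_iff.1 h]; exact hab
    · exact h.1.2
  have hf1 : f (g s₁) < r := by
    rcases h1 with h | h
    · rw [mem_singleton_iff.1 h]; exact hr.1
    · exact h.2.2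
  have hV1 : s₁ = a ∨ g s₁ ∈ levelVertices q m := by
    rcases h1 with h | h
    · exact Or.inl h
    · exact Or.inr h.2.1
  obtain ⟨s₂, h2, h2min⟩ := IsCompact.exists_isLeast
    (isCompact_singleton.union (isCompact_Icc.inter_right
      (hcl {z ∈ levelVertices q m | r < f z} fun z hz => hz.1))) ⟨b, Or.inl (mem_singleton b)⟩
      (s := {b} ∪ (Icc s₁ b ∩ g ⁻¹' {z ∈ levelVertices q m | r < f z}))
  have hs₂b : s₂ ≤ b := h2min (Or.inl rfl)
  have hs₁₂ : s₁ ≤ s₂ := by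
    rcases h2 with h | h
    · rw [mem_singleton_iff.1 h]; exact hs₁b
    · exact h.1.1
  have hf2 : r < f (g s₂) := by
    rcases h2 with h | h
    · rw [mem_singleton_iff.1 h]; exact hr.2
    · exact h.2.2
  have hV2 : s₂ = b ∨ g s₂ ∈ levelVertices q m := by
    rcases h2 with h | h
    · exact Or.inl h
    · exact Or.inr h.2.1
  have hne : s₁ ≠ s₂ := by
    rintro rfl
    exact lt_asymm hf1 hf2
  -- No vertex is visited strictly in between: `f < r` contradicts the choice of `s₁`, `f > r` that
  -- of `s₂`, and `f = r` is excluded by `hrV`.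
  have hdisj : Disjoint (g '' Ioo s₁ s₂) (levelVertices q m) := by
    rw [Set.disjoint_left]
    rintro _ ⟨t, ht, rfl⟩ hV
    rcases lt_trichotomy (f (g t)) r with h | h | h
    · exact ht.1.not_ge (h1max (Or.inr ⟨⟨has₁.trans ht.1.le, ht.2.le.trans hs₂b⟩, hV, h⟩))
    · exact hrV ⟨_, hV, h⟩
    · exact ht.2.not_ge (h2min (Or.inr ⟨⟨ht.1.le, ht.2.le.trans hs₂b⟩, hV, h⟩))
  obtain ⟨w, hw⟩ := exists_subset_cell_of_isPreconnected q
    (isPreconnected_Ioo.image g hg.continuousOn)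
    (by rintro _ ⟨t, -, rfl⟩; exact hgS t) hdisj
  refine ⟨s₁, s₂, has₁, hs₁₂, hs₂b, hf1, hf2, hV1, hV2, w, ?_⟩
  rw [image_subset_iff] at hw ⊢
  rw [← closure_Ioo hne]
  exact closure_minimal hw ((isCompact_cell q w.1).isClosed.preimage hg)

/-- Distinct cells of one level overlap only in the finitely many level vertices, which are
`H¹`-null. -/
theorem sum_hausdorffMeasure_inter_cell_le {m : ℕ} {K : Set (E n)} (hK : IsClosed K)
    (G : Finset (List.Vector (Fin (n + 1)) m)) :
    ∑ w ∈ G, Measure.hausdorffMeasure 1 (K ∩ cell q w.1) ≤ Measure.hausdorffMeasure 1 K := by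
  have := Measure.nullSingletonClass_hausdorff (E n) (d := 1) one_pos
  rw [← measure_biUnion_finset₀]
  · exact measure_mono (iUnion₂_subset fun w _ => inter_subset_left)
  · intro v _ w _ hvw
    refine measure_mono_null ?_ ((finite_levelVertices q m).measure_zero _)
    rintro z ⟨⟨-, hv⟩, -, hw⟩
    exact mem_levelVertices_of_mem_inter q hvw hv hw
  · exact fun w _ =>
      (hK.inter (isCompact_cell q w.1).isClosed).measurableSet.nullMeasurableSet

/-- A function on the gasket whose oscillation on the cells of level `m` is at most `2⁻ᵐ` grows
along a curve by no more than its length, up to an error of order `2⁻ᵐ`. -/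
theorem ofReal_sub_le_hausdorffMeasure_add (hq : IsUnitSimplex q) (m : ℕ) {g : ℝ → E n}
    (hg : Continuous g) (hgS : ∀ t, g t ∈ gasket q) {a b : ℝ} (hab : a ≤ b) (f : E n → ℝ)
    (hf : ∀ w : List.Vector (Fin (n + 1)) m, ∀ x ∈ cell q w.1, ∀ y ∈ cell q w.1,
      f x - f y ≤ (1 / 2) ^ m) :
    ENNReal.ofReal (f (g b) - f (g a)) ≤
      Measure.hausdorffMeasure 1 (g '' Icc a b) + ENNReal.ofReal (4 * (1 / 2) ^ m) := by
  classical
  set δ : ℝ := (1 / 2) ^ m with hδ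
  have hδ0 : 0 ≤ δ := by positivity
  set K := g '' Icc a b with hK
  have hKc : IsCompact K := isCompact_Icc.image hg
  -- The cells of `G` are those in which the curve spends length at least `δ`. Up to the finitely
  -- many values at vertices, each value between `f (g a)` and `f (g b)` is within `δ` of one of
  -- these two or is attained while crossing a cell of `G`, where `f` ranges over an interval of
  -- length `δ`.
  set G : Finset (List.Vector (Fin (n + 1)) m) := Finset.univ.filter fun w =>
    ENNReal.ofReal δ ≤ Measure.hausdorffMeasure 1 (K ∩ cell q w.1) with hG
  have hc : ∀ w : List.Vector (Fin (n + 1)) m, ∃ c, ∀ x ∈ cell q w.1, f x ∈ Icc c (c + δ) := by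
    intro w
    have hbdd : BddBelow (f '' cell q w.1) := by
      refine ⟨f (cellVertex q w.1 0) - δ, ?_⟩
      rintro _ ⟨x, hx, rfl⟩
      linarith [hf w _ (cellVertex_mem_cell q w.1 0) x hx]
    refine ⟨sInf (f '' cell q w.1), fun x hx => ⟨csInf_le hbdd (mem_image_of_mem _ hx), ?_⟩⟩
    rw [← sub_le_iff_le_add]
    refine le_csInf ⟨_, mem_image_of_mem f hx⟩ ?_
    rintro _ ⟨y, hy, rfl⟩
    linarith [hf w x hx y hy]
  choose c hc using hc
  have hcov : Ioo (f (g a)) (f (g b)) \ f '' levelVertices q m ⊆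
      (Icc (f (g a) - δ) (f (g a) + δ) ∪ Icc (f (g b) - δ) (f (g b) + δ)) ∪
        ⋃ w ∈ G, Icc (c w) (c w + δ) := by
    rintro r ⟨hr, hrV⟩
    obtain ⟨s₁, s₂, has₁, hs, hs₂b, hf1, hf2, hV1, hV2, w, hw⟩ :=
      exists_crossing q m hg hgS hab f hr hrV
    have hw1 : g s₁ ∈ cell q w.1 := hw (mem_image_of_mem g (left_mem_Icc.2 hs))
    have hw2 : g s₂ ∈ cell q w.1 := hw (mem_image_of_mem g (right_mem_Icc.2 hs))
    have h12 := hf w _ hw2 _ hw1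
    rcases hV1 with rfl | hV1
    · exact Or.inl (Or.inl ⟨by linarith, by linarith⟩)
    rcases hV2 with rfl | hV2
    · exact Or.inl (Or.inr ⟨by linarith, by linarith⟩)
    refine Or.inr (mem_biUnion (x := w) ?_ ⟨(hc w _ hw1).1.trans hf1.le,
      hf2.le.trans (hc w _ hw2).2⟩)
    -- The crossing joins two vertices of the cell. They are distinct because `f` differs there,
    -- hence at distance `δ`, and a connected piece joining them has length at least `δ`.
    simp only [hG, Finset.coe_filter, Finset.mem_univ, true_and]
    obtain ⟨k₁, hk₁⟩ := exists_eq_cellVertex q hV1 w hw1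
    obtain ⟨k₂, hk₂⟩ := exists_eq_cellVertex q hV2 w hw2
    have hk : k₁ ≠ k₂ := by
      rintro rfl
      rw [hk₁, ← hk₂] at hf1
      exact lt_asymm hf1 hf2
    have hd := dist_cellVertex q hq w.1 hk
    rw [w.2, ← hk₁, ← hk₂] at hd
    have := ofReal_dist_le_hausdorffMeasure (isPreconnected_Icc.image g hg.continuousOn)
      (mem_image_of_mem g (left_mem_Icc.2 hs)) (mem_image_of_mem g (right_mem_Icc.2 hs))
    rw [hd] at this
    exact this.trans (measure_mono
      (subset_inter (image_mono (Icc_subset_Icc has₁ hs₂b)) hw))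
  have hvol : volume (Ioo (f (g a)) (f (g b)) \ f '' levelVertices q m) =
      ENNReal.ofReal (f (g b) - f (g a)) := by
    rw [measure_sdiff_null (((finite_levelVertices q m).image f).measure_zero _), Real.volume_Ioo]
  rw [← hvol]
  calc volume (Ioo (f (g a)) (f (g b)) \ f '' levelVertices q m)
      ≤ (volume (Icc (f (g a) - δ) (f (g a) + δ)) + volume (Icc (f (g b) - δ) (f (g b) + δ))) +
          ∑ w ∈ G, volume (Icc (c w) (c w + δ)) :=
        (measure_mono hcov).trans ((measure_union_le _ _).trans
          (add_le_add (measure_union_le _ _) (measure_biUnion_finset_le _ _)))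
    _ ≤ ENNReal.ofReal (4 * δ) + Measure.hausdorffMeasure 1 K := by
        -- The two end intervals have length `2δ` each, which gives the error `4δ`.
        refine add_le_add ?_ ?_
        · rw [Real.volume_Icc, Real.volume_Icc, ← ENNReal.ofReal_add (by linarith) (by linarith)]
          exact ENNReal.ofReal_le_ofReal (by linarith)
        · refine (Finset.sum_le_sum fun w hw => ?_).trans
            (sum_hausdorffMeasure_inter_cell_le q hKc.isClosed G)
          rw [Real.volume_Icc, add_sub_cancel_left]
          exact (Finset.mem_filter.1 hw).2
    _ = _ := add_comm _ _

/-- A function on the gasket whose oscillation on every small cell is at most the side of the cell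
grows along a curve by no more than its length. -/
theorem ofReal_sub_le_hausdorffMeasure (hq : IsUnitSimplex q) {g : ℝ → E n}
    (hg : Continuous g) (hgS : ∀ t, g t ∈ gasket q) {a b : ℝ} (hab : a ≤ b) (f : E n → ℝ)
    (hf : ∀ w : List (Fin (n + 1)), ∀ x ∈ cell q w, ∀ y ∈ cell q w,
      f x - f y ≤ (1 / 2) ^ w.length) :
    ENNReal.ofReal (f (g b) - f (g a)) ≤ Measure.hausdorffMeasure 1 (g '' Icc a b) := by
  have h : ∀ m : ℕ, ENNReal.ofReal (f (g b) - f (g a)) ≤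
      Measure.hausdorffMeasure 1 (g '' Icc a b) + ENNReal.ofReal (4 * (1 / 2) ^ m) := fun m =>
    ofReal_sub_le_hausdorffMeasure_add q hq m hg hgS hab f fun w x hx y hy => by
      simpa only [w.2] using hf w.1 x hx y hy
  have hlim : Filter.Tendsto (fun m : ℕ => Measure.hausdorffMeasure 1 (g '' Icc a b) +
      ENNReal.ofReal (4 * (1 / 2) ^ m)) Filter.atTop
      (nhds (Measure.hausdorffMeasure 1 (g '' Icc a b) + ENNReal.ofReal (4 * 0))) :=
    tendsto_const_nhds.add ((ENNReal.continuous_ofReal.tendsto _).comp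
      ((tendsto_pow_atTop_nhds_zero_of_lt_one (by norm_num) (by norm_num)).const_mul 4))
  simpa using ge_of_tendsto' hlim h

end LowerBound

/-! ### Lipschitz curves in the gasket. -/

section Join

variable {n : ℕ} (q : AffineBasis (Fin (n + 1)) ℝ (E n))

/-- The points `x` and `y` are joined by a `1`-Lipschitz curve in the gasket in time `L`. -/
def Join (x y : E n) (L : ℝ) : Prop :=
  0 ≤ L ∧ ∃ f : ℝ → E n, LipschitzWith 1 f ∧ (∀ t, f t ∈ gasket q) ∧ f 0 = x ∧ f L = y

variable {q}

theorem lipschitzWith_one_of_abs {f : ℝ → E n} (h : ∀ s t, s ≤ t → dist (f s) (f t) ≤ t - s) :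
    LipschitzWith 1 f := by
  refine LipschitzWith.of_dist_le_mul fun s t => ?_
  rw [NNReal.coe_one, one_mul, Real.dist_eq]
  rcases le_total s t with hst | hst
  · rw [abs_sub_comm, abs_of_nonneg (sub_nonneg.2 hst)]
    exact h s t hst
  · rw [abs_of_nonneg (sub_nonneg.2 hst), dist_comm]
    exact h t s hst

theorem dist_le_of_lipschitzWith_one {f : ℝ → E n} (hf : LipschitzWith 1 f) {s t : ℝ}
    (hst : s ≤ t) : dist (f s) (f t) ≤ t - s := by
  have := hf.dist_le_mul s t
  rwa [NNReal.coe_one, one_mul, Real.dist_eq, abs_sub_comm, abs_of_nonneg (sub_nonneg.2 hst)]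
    at this

theorem Join.refl {x : E n} (hx : x ∈ gasket q) : Join q x x 0 :=
  ⟨le_rfl, fun _ => x, LipschitzWith.const x |>.weaken zero_le_one, fun _ => hx, rfl, rfl⟩

theorem Join.symm {x y : E n} {L : ℝ} (h : Join q x y L) : Join q y x L := by
  obtain ⟨hL, f, hf, hfS, rfl, rfl⟩ := h
  refine ⟨hL, fun t => f (L - t), lipschitzWith_one_of_abs fun s t hst => ?_, fun t => hfS _,
    by simp, by simp⟩
  rw [dist_comm]
  exact (dist_le_of_lipschitzWith_one hf (by linarith)).trans (by linarith)

theorem Join.trans {x y z : E n} {L M : ℝ} (h : Join q x y L) (h' : Join q y z M) :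
    Join q x z (L + M) := by
  obtain ⟨hL, f, hf, hfS, rfl, hy⟩ := h
  obtain ⟨hM, g, hg, hgS, hy', rfl⟩ := h'
  refine ⟨add_nonneg hL hM, fun t => if t ≤ L then f t else g (t - L),
    lipschitzWith_one_of_abs fun s t hst => ?_, fun t => ?_, by simp [hL], ?_⟩
  · by_cases hs : s ≤ L
    · by_cases ht : t ≤ L
      · simp only [hs, ht, if_true]
        exact dist_le_of_lipschitzWith_one hf hst
      · simp only [hs, ht, if_true, if_false]
        have h1 := dist_le_of_lipschitzWith_one hf hs
        have h2 := dist_le_of_lipschitzWith_one hg (sub_nonneg.2 (not_le.1 ht).le)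
        rw [hy] at h1
        rw [hy'] at h2
        linarith [dist_triangle (f s) y (g (t - L))]
    · have ht : ¬t ≤ L := fun ht => hs (hst.trans ht)
      simp only [hs, ht, if_false]
      exact (dist_le_of_lipschitzWith_one hg (by linarith)).trans (by linarith)
  · dsimp only
    split_ifs
    exacts [hfS _, hgS _]
  · dsimp only
    split_ifs with h0
    · have hM0 : M = 0 := by linarith
      rw [hM0, add_zero, hy, hy']
    · rw [add_sub_cancel_left]

theorem Join.map_F {x y : E n} {L : ℝ} (h : Join q x y L) (i : Fin (n + 1)) :
    Join q (F q i x) (F q i y) ((1 / 2) * L) := by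
  obtain ⟨hL, f, hf, hfS, rfl, rfl⟩ := h
  refine ⟨by positivity, fun t => F q i (f (2 * t)), lipschitzWith_one_of_abs fun s t hst => ?_,
    fun t => F_mem_gasket q i (hfS _), by simp, by simp⟩
  rw [dist_F]
  linarith [dist_le_of_lipschitzWith_one hf (show 2 * s ≤ 2 * t by linarith)]

theorem Join.map_wordMap {x y : E n} {L : ℝ} (h : Join q x y L) (w : List (Fin (n + 1))) :
    Join q (wordMap q w x) (wordMap q w y) ((1 / 2) ^ w.length * L) := by
  induction w with
  | nil => simpa using h
  | cons i w ih =>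
    have := ih.map_F i
    rwa [← mul_assoc, ← pow_succ'] at this

/-- An edge of the simplex is covered by its two half-size copies at its end points, so it lies in
the attractor. -/
theorem lineMap_vertex_mem_gasket (i j : Fin (n + 1)) {t : ℝ} (ht : t ∈ Icc (0 : ℝ) 1) :
    AffineMap.lineMap (q i) (q j) t ∈ gasket q := by
  refine subset_of_invariant q (K := AffineMap.lineMap (q i) (q j) '' Icc (0 : ℝ) 1)
    (isCompact_Icc.image AffineMap.lineMap_continuous) ⟨_, mem_image_of_mem _ ht⟩ ?_
    (isCompact_gasket q).isClosed (gasket_nonempty q) (gasket_eq_iUnion q).symm.subset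
    (mem_image_of_mem _ ht)
  rintro _ ⟨s, hs, rfl⟩
  rcases le_total s (1 / 2) with h | h
  · refine mem_iUnion.2 ⟨i, _, ⟨2 * s, ⟨by linarith [hs.1], by linarith⟩, rfl⟩, ?_⟩
    rw [F, AffineMap.lineMap_apply_module, AffineMap.lineMap_apply_module]
    module
  · refine mem_iUnion.2 ⟨j, _, ⟨2 * s - 1, ⟨by linarith, by linarith [hs.2]⟩, rfl⟩, ?_⟩
    rw [F, AffineMap.lineMap_apply_module, AffineMap.lineMap_apply_module]
    module

theorem join_vertices (hq : IsUnitSimplex q) {i j : Fin (n + 1)} (hij : i ≠ j) :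
    Join q (q i) (q j) 1 := by
  refine ⟨zero_le_one, fun t => AffineMap.lineMap (q i) (q j) (max 0 (min t 1)),
    lipschitzWith_one_of_abs fun s t hst => ?_, fun t => lineMap_vertex_mem_gasket i j
      ⟨le_max_left _ _, max_le zero_le_one (min_le_right _ _)⟩, by simp, by simp⟩
  rw [dist_lineMap_lineMap, hq i j hij, mul_one, Real.dist_eq, abs_sub_comm]
  rw [abs_of_nonneg (sub_nonneg.2 (max_le_max le_rfl (min_le_min_right _ hst)))]
  rcases max_cases 0 (min t 1) with h | h <;> rcases min_cases t 1 with h' | h' <;>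
    rcases max_cases 0 (min s 1) with h'' | h'' <;> rcases min_cases s 1 with h3 | h3 <;> linarith

/-- Compactness of the gasket and Tychonoff's theorem give a pointwise limit of the curves along an
ultrafilter. The 1-Lipschitz bound survives pointwise limits, and it also absorbs the varying final
times `L k`. -/
theorem Join.of_tendsto {x y : ℕ → E n} {L : ℕ → ℝ} {x₀ y₀ : E n} {L₀ : ℝ}
    (h : ∀ k, Join q (x k) (y k) (L k)) (hx : Filter.Tendsto x Filter.atTop (nhds x₀))
    (hy : Filter.Tendsto y Filter.atTop (nhds y₀))
    (hL : Filter.Tendsto L Filter.atTop (nhds L₀)) : Join q x₀ y₀ L₀ := by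
  choose hL0 f hf hfS hfx hfy using h
  set 𝒰 := Ultrafilter.of (Filter.atTop : Filter ℕ) with h𝒰
  have hle : (𝒰 : Filter ℕ) ≤ Filter.atTop := Ultrafilter.of_le _
  obtain ⟨g, hgS, hg⟩ := (isCompact_univ_pi fun _ : ℝ => isCompact_gasket q).ultrafilter_le_nhds
    (𝒰.map f) (Filter.le_principal_iff.2 (Filter.mem_map.2 (Filter.univ_mem'
      fun k t _ => hfS k t)))
  have hg' : Filter.Tendsto f 𝒰 (nhds g) := hg
  rw [tendsto_pi_nhds] at hg'
  refine ⟨ge_of_tendsto' hL hL0, g, LipschitzWith.of_dist_le_mul fun s t => ?_,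
    fun t => hgS t (mem_univ t), ?_, ?_⟩
  · exact le_of_tendsto' ((hg' s).dist (hg' t)) fun k => (hf k).dist_le_mul s t
  · refine tendsto_nhds_unique (hg' 0) ?_
    simp only [hfx]
    exact hx.mono_left hle
  · refine tendsto_nhds_unique (hg' L₀) ((hy.mono_left hle).congr_dist ?_)
    refine squeeze_zero (g := fun k => dist (L k) L₀) (fun _ => dist_nonneg) (fun k => ?_)
      (tendsto_iff_dist_tendsto_zero.1 (hL.mono_left hle))
    rw [← hfy k]
    simpa using (hf k).dist_le_mul (L k) L₀

/-- The curve follows edges of cells towards `q j`. A first letter `i ≠ j` costs an extra half unit,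
from `F_i q_j = F_j q_i` to `q_j`; a first letter `j` costs nothing extra. This is the recursion of
`1 - [x]_j`. It is run on approximations of `x` obtained by replacing the tail of an address by `q
j`, followed by a limit. -/
theorem join_vertex (hq : IsUnitSimplex q) (j : Fin (n + 1)) {x : E n} (hx : x ∈ gasket q) :
    Join q x (q j) (1 - q.coord j x) := by
  obtain ⟨D, hD⟩ := (Metric.isBounded_iff.1 (isCompact_gasket q).isBounded)
  have key : ∀ m : ℕ, ∀ x ∈ gasket q, ∃ y ∈ gasket q, dist y x ≤ (1 / 2) ^ m * D ∧
      Join q y (q j) (1 - q.coord j y) := by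
    intro m
    induction m with
    | zero =>
      intro x hx
      refine ⟨q j, vertex_mem_gasket q j, ?_, ?_⟩
      · rw [pow_zero, one_mul]
        exact hD (vertex_mem_gasket q j) hx
      · simpa using Join.refl (vertex_mem_gasket q j)
    | succ m ih =>
      intro x hx
      rw [gasket_eq_iUnion] at hx
      obtain ⟨i, x', hx', rfl⟩ := mem_iUnion.1 hx
      obtain ⟨y, hy, hyx, hJ⟩ := ih x' hx'
      refine ⟨F q i y, F_mem_gasket q i hy, ?_, ?_⟩
      · rw [dist_F, pow_succ', mul_assoc]
        linarith
      · have h1 := hJ.map_F i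
        rw [coord_F]
        split_ifs with hji
        · subst hji
          rw [F_vertex] at h1
          convert h1 using 1
          ring
        · have h2 := (join_vertices hq (Ne.symm hji)).map_F j
          rw [F_vertex, show F q j (q i) = F q i (q j) by rw [F, F, add_comm]] at h2
          convert h1.trans h2 using 1
          ring
  choose y hyS hyx hJ using fun m => key m x hx
  have hlim : Filter.Tendsto y Filter.atTop (nhds x) := by
    rw [tendsto_iff_dist_tendsto_zero]
    refine squeeze_zero (fun _ => dist_nonneg) hyx ?_
    simpa using (tendsto_pow_atTop_nhds_zero_of_lt_one (r := (1 / 2 : ℝ)) (by norm_num)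
      (by norm_num)).mul_const D
  exact Join.of_tendsto hJ hlim tendsto_const_nhds
    (tendsto_const_nhds.sub (((continuous_coord q j).tendsto x).comp hlim))

end Join

/-! ### The intrinsic distance as a real number, and its exact value to a vertex. -/

section GasketDist

variable {n : ℕ} {q : AffineBasis (Fin (n + 1)) ℝ (E n)}

variable (q) in
/-- The least length of a rectifiable curve in the gasket from `x` to `y`. -/
def gdist (x y : E n) : ℝ := sInf {L | Join q x y L}

theorem gdist_le {x y : E n} {L : ℝ} (h : Join q x y L) : gdist q x y ≤ L :=
  csInf_le ⟨0, fun _ h => h.1⟩ h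

theorem join_gdist (hq : IsUnitSimplex q) {x y : E n} (hx : x ∈ gasket q) (hy : y ∈ gasket q) :
    Join q x y (gdist q x y) := by
  have hcl : IsClosed {L | Join q x y L} := by
    refine IsSeqClosed.isClosed fun L L₀ hL hlim => ?_
    exact Join.of_tendsto hL tendsto_const_nhds tendsto_const_nhds hlim
  exact hcl.csInf_mem ⟨_, (join_vertex hq 0 hx).trans (join_vertex hq 0 hy).symm⟩
    ⟨0, fun _ h => h.1⟩

theorem gdist_nonneg (x y : E n) : 0 ≤ gdist q x y := Real.sInf_nonneg fun _ h => h.1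

theorem gdist_self {x : E n} (hx : x ∈ gasket q) : gdist q x x = 0 :=
  le_antisymm (gdist_le (Join.refl hx)) (gdist_nonneg x x)

theorem gdist_triangle (hq : IsUnitSimplex q) {x y z : E n} (hx : x ∈ gasket q)
    (hy : y ∈ gasket q) (hz : z ∈ gasket q) : gdist q x z ≤ gdist q x y + gdist q y z :=
  gdist_le ((join_gdist hq hx hy).trans (join_gdist hq hy hz))

theorem gdist_wordMap_le (hq : IsUnitSimplex q) (w : List (Fin (n + 1))) {x y : E n}
    (hx : x ∈ gasket q) (hy : y ∈ gasket q) :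
    gdist q (wordMap q w x) (wordMap q w y) ≤ (1 / 2) ^ w.length * gdist q x y :=
  gdist_le ((join_gdist hq hx hy).map_wordMap w)

theorem gdist_vertex_le (hq : IsUnitSimplex q) (j : Fin (n + 1)) {x : E n} (hx : x ∈ gasket q) :
    gdist q x (q j) ≤ 1 - q.coord j x :=
  gdist_le (join_vertex hq j hx)

theorem gdist_comm (x y : E n) : gdist q x y = gdist q y x := by
  unfold gdist
  congr 1
  ext L
  exact ⟨Join.symm, Join.symm⟩

/-- The sharp constant `1` is needed so that the distance to a point oscillates by at most `2⁻ᵐ` on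
cells of level `m`. A detour through a vertex gives only `2`, and the bound then improves itself:
two points in one subcell are handled by scaling, and points in different subcells are joined
through the common vertex at cost at most `1/2 + 1/2`. -/
theorem gdist_le_one (hq : IsUnitSimplex q) {x y : E n} (hx : x ∈ gasket q) (hy : y ∈ gasket q) :
    gdist q x y ≤ 1 := by
  have hv : ∀ j, ∀ x ∈ gasket q, gdist q x (q j) ≤ 1 := fun j x hx =>
    (gdist_vertex_le hq j hx).trans (by linarith [coord_nonneg q j hx])
  have hF : ∀ i, ∀ x ∈ gasket q, ∀ y ∈ gasket q,
      gdist q (F q i x) (F q i y) ≤ (1 / 2) * gdist q x y := fun i x hx y hy =>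
    gdist_le ((join_gdist hq hx hy).map_F i)
  have key : ∀ m : ℕ, ∀ x ∈ gasket q, ∀ y ∈ gasket q, gdist q x y ≤ 1 + (1 / 2) ^ m := by
    intro m
    induction m with
    | zero =>
      intro x hx y hy
      have := gdist_triangle hq hx (vertex_mem_gasket q 0) hy
      rw [gdist_comm (q 0) y] at this
      linarith [hv 0 x hx, hv 0 y hy]
    | succ m ih =>
      intro x hx y hy
      obtain ⟨i, x, hx', rfl⟩ := mem_iUnion.1 ((gasket_eq_iUnion q).subset hx)
      obtain ⟨j, y, hy', rfl⟩ := mem_iUnion.1 ((gasket_eq_iUnion q).subset hy)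
      by_cases hij : i = j
      · subst hij
        have h1 := hF i x hx' y hy'
        have h2 := ih x hx' y hy'
        rw [pow_succ]
        linarith
      · have h1 := hF i x hx' (q j) (vertex_mem_gasket q j)
        have h2 := hF j (q i) (vertex_mem_gasket q i) y hy'
        rw [show F q j (q i) = F q i (q j) by rw [F, F, add_comm]] at h2
        have h3 := gdist_triangle hq hx
          (F_mem_gasket q i (vertex_mem_gasket q j)) hy
        have h4 := hv j x hx'
        have h5 := hv i y hy'
        rw [gdist_comm] at h5
        have : (0 : ℝ) ≤ (1 / 2) ^ (m + 1) := by positivity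
        linarith
  have hlim : Filter.Tendsto (fun m : ℕ => 1 + (1 / 2 : ℝ) ^ m) Filter.atTop (nhds (1 + 0)) :=
    tendsto_const_nhds.add (tendsto_pow_atTop_nhds_zero_of_lt_one (by norm_num) (by norm_num))
  simpa using ge_of_tendsto' hlim fun m => key m x hx y hy

theorem gdist_le_of_mem_cell (hq : IsUnitSimplex q) {w : List (Fin (n + 1))} {x y : E n}
    (hx : x ∈ cell q w) (hy : y ∈ cell q w) : gdist q x y ≤ (1 / 2) ^ w.length := by
  obtain ⟨x, hx, rfl⟩ := hx
  obtain ⟨y, hy, rfl⟩ := hy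
  exact (gdist_wordMap_le hq w hx hy).trans
    (mul_le_of_le_one_right (by positivity) (gdist_le_one hq hx hy))

theorem hausdorffMeasure_image_Icc_le {f : ℝ → E n} (hf : LipschitzWith 1 f) (a b : ℝ) :
    Measure.hausdorffMeasure 1 (f '' Icc a b) ≤ ENNReal.ofReal (b - a) := by
  have := hf.lipschitzOnWith (s := Icc a b) |>.hausdorffMeasure_image_le (d := 1) zero_le_one
  rwa [hausdorffMeasure_real, Real.volume_Icc, ENNReal.coe_one, ENNReal.one_rpow, one_mul] at this

/-- The growth bound along curves applies to `gdist q (g a)`, by the triangle inequality and the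
diameter bound for cells. -/
theorem ofReal_gdist_le (hq : IsUnitSimplex q) {g : ℝ → E n} (hg : Continuous g)
    (hgS : ∀ t, g t ∈ gasket q) {a b : ℝ} (hab : a ≤ b) :
    ENNReal.ofReal (gdist q (g a) (g b)) ≤ Measure.hausdorffMeasure 1 (g '' Icc a b) := by
  have h := ofReal_sub_le_hausdorffMeasure q hq hg hgS hab (gdist q (g a)) fun w x hx y hy => by
    have h1 := gdist_triangle hq (hgS a) (cell_subset_gasket q w hy) (cell_subset_gasket q w hx)
    linarith [gdist_le_of_mem_cell hq hy hx]
  rwa [gdist_self (hgS a), sub_zero] at h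

/-- Every cell of level `m` is, in barycentric coordinates, the standard simplex scaled by `2⁻ᵐ`
and translated by this vector times `2⁻ᵐ`. -/
def corner : List (Fin (n + 1)) → Fin (n + 1) → ℤ
  | [], _ => 0
  | i :: w, k => corner w k + if k = i then 2 ^ w.length else 0

theorem coord_wordMap (w : List (Fin (n + 1))) (k : Fin (n + 1)) (x : E n) :
    q.coord k (wordMap q w x) = (1 / 2) ^ w.length * (corner w k + q.coord k x) := by
  induction w with
  | nil => simp [corner]
  | cons i w ih =>
    rw [wordMap_cons, coord_F, ih, List.length_cons, pow_succ, corner]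
    have h2 : (1 / 2 : ℝ) ^ w.length * 2 ^ w.length = 1 := by
      rw [← mul_pow]
      norm_num
    split_ifs
    · push_cast
      linear_combination (-(1 / 2) : ℝ) * h2
    · push_cast
      ring

/-- The upper bound scales the explicit curve of `join_vertex`. For the lower bound the `j`-th
coordinate serves as growth function: on a cell of level `m` it varies by at most `2⁻ᵐ`. -/
theorem gdist_vertex (hq : IsUnitSimplex q) (w : List (Fin (n + 1))) (j : Fin (n + 1)) {x : E n}
    (hx : x ∈ gasket q) :
    gdist q (wordMap q w x) (cellVertex q w j) = (1 / 2) ^ w.length * (1 - q.coord j x) := by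
  refine le_antisymm ((gdist_wordMap_le hq w hx (vertex_mem_gasket q j)).trans
    (mul_le_mul_of_nonneg_left (gdist_vertex_le hq j hx) (by positivity))) ?_
  obtain ⟨h0, f, hf, hfS, hfx, hfy⟩ := join_gdist hq (wordMap_mem_gasket q w hx)
    (cell_subset_gasket q w (cellVertex_mem_cell q w j))
  have h := ofReal_sub_le_hausdorffMeasure q hq hf.continuous hfS h0 (q.coord j)
    fun v y hy z hz => by
      obtain ⟨y, hy, rfl⟩ := hy
      obtain ⟨z, hz, rfl⟩ := hz
      rw [coord_wordMap, coord_wordMap, ← mul_sub]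
      exact mul_le_of_le_one_right (by positivity)
        (by linarith [coord_le_one q j hy, coord_nonneg q j hz])
  have h1 := h.trans (hausdorffMeasure_image_Icc_le hf _ _)
  rw [sub_zero, ENNReal.ofReal_le_ofReal_iff h0, hfx, hfy] at h1
  refine le_trans (le_of_eq ?_) h1
  rw [cellVertex, coord_wordMap, coord_wordMap, AffineBasis.coord_apply_eq]
  ring

end GasketDist

/-! ### Comparison of the intrinsic and the Euclidean metric. -/

section Bilipschitz

variable {n : ℕ} {q : AffineBasis (Fin (n + 1)) ℝ (E n)}

theorem sum_corner (q : AffineBasis (Fin (n + 1)) ℝ (E n)) (w : List (Fin (n + 1))) :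
    ∑ k, corner w k = 2 ^ w.length - 1 := by
  have h := q.sum_coord_apply_eq_one (wordMap q w (q 0))
  simp_rw [coord_wordMap] at h
  rw [← Finset.mul_sum, Finset.sum_add_distrib, q.sum_coord_apply_eq_one] at h
  have h2 : (1 / 2 : ℝ) ^ w.length * 2 ^ w.length = 1 := by
    rw [← mul_pow]
    norm_num
  have h3 : (∑ k, (corner w k : ℝ)) + 1 = 2 ^ w.length :=
    mul_left_cancel₀ (by positivity) (h.trans h2.symm)
  have h4 : (∑ k, corner w k) + 1 = 2 ^ w.length := by exact_mod_cast h3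
  linarith

/-- This is applied to the difference of the corners of two cells: if that difference is zero or
`e_k - e_l`, the cells share a vertex. -/
theorem exists_add_eq_add_of_sum_max_le_one {ι : Type*} [Fintype ι] [DecidableEq ι] [Nonempty ι]
    {B : ι → ℤ} (h0 : ∑ k, B k = 0) (h1 : ∑ k, max (B k) 0 ≤ 1) :
    ∃ k l, ∀ j, B j = (if j = k then 1 else 0) - if j = l then 1 else 0 := by
  by_cases hB : ∀ j, B j = 0
  · obtain ⟨k⟩ := ‹Nonempty ι›
    exact ⟨k, k, fun j => by rw [hB, sub_self]⟩
  have hpos : ∃ k, 0 < B k := by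
    by_contra! hneg
    exact hB fun j => (Finset.sum_eq_zero_iff_of_nonpos fun j _ => hneg j).1 h0 j
      (Finset.mem_univ j)
  obtain ⟨k, hk⟩ := hpos
  have hrest : ∑ j ∈ Finset.univ.erase k, max (B j) 0 ≤ 0 := by
    have := Finset.add_sum_erase Finset.univ (fun j => max (B j) 0) (Finset.mem_univ k)
    have h2 : B k ≤ max (B k) 0 := le_max_left _ _
    omega
  have hk1 : B k = 1 := by
    have := Finset.single_le_sum (f := fun j => max (B j) 0) (fun j _ => le_max_right _ _)
      (Finset.mem_univ k)
    have h2 : B k ≤ max (B k) 0 := le_max_left _ _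
    omega
  have hle : ∀ j, j ≠ k → B j ≤ 0 := by
    intro j hj
    have := Finset.single_le_sum (f := fun j => max (B j) 0) (fun j _ => le_max_right _ _)
      (Finset.mem_erase.2 ⟨hj, Finset.mem_univ j⟩)
    exact (le_max_left _ _).trans (this.trans hrest)
  have hsum : ∑ j ∈ Finset.univ.erase k, B j = -1 := by
    have := Finset.add_sum_erase Finset.univ B (Finset.mem_univ k)
    omega
  have hneg : ∃ l ∈ Finset.univ.erase k, B l < 0 := by
    by_contra! hge
    have := Finset.sum_nonneg hge
    omega
  obtain ⟨l, hl, hlneg⟩ := hneg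
  have hlk := (Finset.mem_erase.1 hl).1
  have hsum2 := Finset.add_sum_erase _ B hl
  have hrest2 : ∑ j ∈ (Finset.univ.erase k).erase l, B j ≤ 0 :=
    Finset.sum_nonpos fun j hj =>
      hle j (Finset.mem_erase.1 (Finset.mem_of_mem_erase hj)).1
  have hz : ∑ j ∈ (Finset.univ.erase k).erase l, B j = 0 := by omega
  have hl1 : B l = -1 := by omega
  refine ⟨k, l, fun j => ?_⟩
  by_cases hjk : j = k
  · subst hjk
    rw [if_pos rfl, if_neg (Ne.symm hlk), hk1, sub_zero]
  by_cases hjl : j = l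
  · subst hjl
    rw [if_pos rfl, if_neg hjk, hl1, zero_sub]
  rw [if_neg hjk, if_neg hjl, sub_zero]
  exact (Finset.sum_eq_zero_iff_of_nonpos fun j hj =>
    hle j (Finset.mem_erase.1 (Finset.mem_of_mem_erase hj)).1).1 hz j
      (Finset.mem_erase.2 ⟨hjl, Finset.mem_erase.2 ⟨hjk, Finset.mem_univ j⟩⟩)

/-- Two cells of level `m` that contain points at small distance share a vertex. -/
theorem exists_cellVertex_eq {v w : List (Fin (n + 1))} (hvw : v.length = w.length) {x y : E n}
    (hx : x ∈ cell q v) (hy : y ∈ cell q w)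
    (h : ∑ k, max (q.coord k x - q.coord k y) 0 < (1 / 2) ^ v.length) :
    ∃ k l, cellVertex q v k = cellVertex q w l := by
  classical
  obtain ⟨x, hx, rfl⟩ := hx
  obtain ⟨y, hy, rfl⟩ := hy
  have hp : (0 : ℝ) < (1 / 2) ^ v.length := by positivity
  have h1 : ∑ k, max (corner v k - corner w k) 0 ≤ 1 := by
    -- The positions inside the cells contribute at most `2⁻ᵐ` in total, since the coordinates of
    -- `y` sum to `1`. With the hypothesis, the positive part of the integer vector sums to less
    -- than `2`.
    have hk : ∀ k, ((max (corner v k - corner w k) 0 : ℤ) : ℝ) * (1 / 2) ^ v.length ≤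
        max (q.coord k (wordMap q v x) - q.coord k (wordMap q w y)) 0 +
          q.coord k y * (1 / 2) ^ v.length := by
      intro k
      rw [coord_wordMap, coord_wordMap, ← hvw, ← mul_sub]
      push_cast
      rw [max_mul_of_nonneg _ _ hp.le]
      have hy0 := mul_nonneg (coord_nonneg q k hy) hp.le
      have hx0 := mul_nonneg (coord_nonneg q k hx) hp.le
      refine max_le ?_ ?_
      · refine le_trans ?_ (add_le_add_left (le_max_left _ _) _)
        linarith
      · rw [zero_mul]
        exact add_nonneg (le_max_right _ _) hy0
    have hs := Finset.sum_le_sum fun k (_ : k ∈ Finset.univ) => hk k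
    rw [← Finset.sum_mul, Finset.sum_add_distrib, ← Finset.sum_mul, q.sum_coord_apply_eq_one,
      one_mul] at hs
    have h2 : (∑ k, ((max (corner v k - corner w k) 0 : ℤ) : ℝ)) * (1 / 2) ^ v.length <
        2 * (1 / 2) ^ v.length := by linarith
    have h3 := lt_of_mul_lt_mul_right h2 hp.le
    have h4 : ∑ k, max (corner v k - corner w k) 0 < 2 := by exact_mod_cast h3
    omega
  have h0 : ∑ k, (corner v k - corner w k) = 0 := by
    rw [Finset.sum_sub_distrib, sum_corner q, sum_corner q, hvw, sub_self]
  obtain ⟨k, l, hkl⟩ := exists_add_eq_add_of_sum_max_le_one h0 h1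
  refine ⟨l, k, eq_of_coord_eq q fun j => ?_⟩
  rw [cellVertex, cellVertex, coord_wordMap, coord_wordMap, hvw, AffineBasis.coord_apply,
    AffineBasis.coord_apply]
  congr 1
  have h5 : (corner v j : ℝ) - corner w j = (if j = k then 1 else 0) - if j = l then 1 else 0 := by
    exact_mod_cast hkl j
  linarith

/-- The intrinsic distance on the gasket is bounded by a multiple of the Euclidean distance. -/
theorem exists_gdist_le_mul_dist (hq : IsUnitSimplex q) :
    ∃ C : NNReal, ∀ x ∈ gasket q, ∀ y ∈ gasket q, gdist q x y ≤ C * dist x y := by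
  have hlip : ∃ C : NNReal, ∀ x y : E n,
      ∑ k, max (q.coord k x - q.coord k y) 0 ≤ C * dist x y := by
    refine ⟨∑ k, ‖LinearMap.toContinuousLinearMap (q.coord k).linear‖₊, fun x y => ?_⟩
    rw [NNReal.coe_sum, Finset.sum_mul]
    refine Finset.sum_le_sum fun k _ => max_le ?_ (by positivity)
    rw [dist_eq_norm, coe_nnnorm]
    have h1 : q.coord k x - q.coord k y =
        LinearMap.toContinuousLinearMap (q.coord k).linear (x - y) := by
      rw [LinearMap.coe_toContinuousLinearMap', ← vsub_eq_sub x y, AffineMap.linearMap_vsub,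
        vsub_eq_sub]
    rw [h1]
    exact (le_abs_self _).trans
      ((LinearMap.toContinuousLinearMap (q.coord k).linear).le_opNorm (x - y))
  obtain ⟨C, hC⟩ := hlip
  refine ⟨8 * C, fun x hx y hy => ?_⟩
  suffices h : gdist q x y ≤ 8 * ∑ k, max (q.coord k x - q.coord k y) 0 by
    refine h.trans ?_
    push_cast
    rw [mul_assoc]
    exact mul_le_mul_of_nonneg_left (hC x y) (by norm_num)
  set N := ∑ k, max (q.coord k x - q.coord k y) 0 with hN
  rcases (show 0 ≤ N from Finset.sum_nonneg fun k _ => le_max_right _ _).eq_or_lt with h0 | h0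
  · have hle : ∀ k, q.coord k x ≤ q.coord k y := fun k => by
      have := (Finset.sum_eq_zero_iff_of_nonneg fun k _ =>
        le_max_right (q.coord k x - q.coord k y) 0).1 h0.symm k (Finset.mem_univ k)
      linarith [le_max_left (q.coord k x - q.coord k y) 0]
    have heq : ∀ k, q.coord k x = q.coord k y := by
      have := (Finset.sum_eq_sum_iff_of_le fun k (_ : k ∈ Finset.univ) => hle k).1
        (by rw [q.sum_coord_apply_eq_one, q.sum_coord_apply_eq_one])
      exact fun k => this k (Finset.mem_univ k)
    rw [eq_of_coord_eq q heq, gdist_self hy, ← h0, mul_zero]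
  have h1 : N ≤ 1 := by
    rw [← q.sum_coord_apply_eq_one x]
    refine Finset.sum_le_sum fun k _ => max_le ?_ (coord_nonneg q k hx)
    linarith [coord_nonneg q k hy]
  -- Here `2⁻⁽ᵐ⁺¹⁾ < N ≤ 2⁻ᵐ`. Passing to cells one level coarser makes `N` strictly smaller than
  -- their side, so they share a vertex. Two such sides make up `8` times the lower bound for `N`,
  -- whence the constant.
  obtain ⟨m, hm1, hm2⟩ := exists_nat_pow_near_of_lt_one h0 h1 (show (0 : ℝ) < 1 / 2 by norm_num)
    (by norm_num)
  cases m with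
  | zero =>
    norm_num at hm1
    linarith [gdist_le_one hq hx hy]
  | succ m =>
    obtain ⟨v, hv⟩ := exists_mem_cell q m hx
    obtain ⟨w, hw⟩ := exists_mem_cell q m hy
    have hp : (0 : ℝ) < (1 / 2) ^ m := by positivity
    rw [pow_succ] at hm1 hm2
    rw [pow_succ] at hm1
    obtain ⟨k, l, hkl⟩ := exists_cellVertex_eq (v.2.trans w.2.symm) hv hw
      (by rw [v.2]; linarith)
    have h2 := gdist_le_of_mem_cell hq hv (cellVertex_mem_cell q v.1 k)
    have h3 := gdist_le_of_mem_cell hq (cellVertex_mem_cell q w.1 l) hw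
    have h4 := gdist_triangle hq hx (cell_subset_gasket q v.1 (cellVertex_mem_cell q v.1 k)) hy
    rw [v.2] at h2
    rw [w.2, ← hkl] at h3
    linarith

end Bilipschitz

/-! ### Existence, injectivity and subpaths of geodesics. -/

section Geodesics

variable {n : ℕ} {q : AffineBasis (Fin (n + 1)) ℝ (E n)}

theorem ofReal_gdist_le_hausdorffMeasure_range (hq : IsUnitSimplex q) {x y : E n} (γ : Path x y)
    (hγ : range γ ⊆ gasket q) :
    ENNReal.ofReal (gdist q x y) ≤ Measure.hausdorffMeasure 1 (range γ) := by
  have h := ofReal_gdist_le hq γ.continuous_extend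
    (fun t => hγ (γ.extend_range.subset (mem_range_self t))) zero_le_one
  rw [γ.extend_zero, γ.extend_one] at h
  exact h.trans (measure_mono ((image_subset_range _ _).trans γ.extend_range.subset))

theorem dist_le_gdist (hq : IsUnitSimplex q) {x y : E n} (hx : x ∈ gasket q) (hy : y ∈ gasket q) :
    dist x y ≤ gdist q x y := by
  obtain ⟨h0, f, hf, -, hfx, hfy⟩ := join_gdist hq hx hy
  have := dist_le_of_lipschitzWith_one hf h0
  rwa [hfx, hfy, sub_zero] at this

theorem exists_isGeodesic_and_intrinsicDist_eq (hq : IsUnitSimplex q) {x y : E n}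
    (hx : x ∈ gasket q) (hy : y ∈ gasket q) :
    intrinsicDist q x y = ENNReal.ofReal (gdist q x y) ∧ ∃ γ : Path x y, IsGeodesic q γ := by
  obtain ⟨h0, f, hf, hfS, hfx, hfy⟩ := join_gdist hq hx hy
  set L := gdist q x y with hL
  let γ : Path x y :=
    { toFun := fun u => f (u * L)
      continuous_toFun := hf.continuous.comp (by fun_prop)
      source' := by simpa using hfx
      target' := by simpa using hfy }
  have hγS : range γ ⊆ gasket q := by
    rintro _ ⟨u, rfl⟩
    exact hfS _
  have hle : ∀ t : I, Measure.hausdorffMeasure 1 (γ '' Icc 0 t) ≤ ENNReal.ofReal (t * L) := by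
    intro t
    refine (measure_mono ?_).trans ((hausdorffMeasure_image_Icc_le hf 0 (t * L)).trans
      (by rw [sub_zero]))
    rintro _ ⟨u, hu, rfl⟩
    exact ⟨u * L, ⟨mul_nonneg u.2.1 h0, mul_le_mul_of_nonneg_right hu.2 h0⟩, rfl⟩
  have hlow := ofReal_gdist_le_hausdorffMeasure_range hq γ hγS
  have hrange : range γ = γ '' Icc 0 1 := by
    rw [← image_univ]
    congr 1
    exact (eq_univ_of_forall fun u => show u ∈ Icc (0 : I) 1 from ⟨u.2.1, u.2.2⟩).symm
  have hlen : pathLength γ = ENNReal.ofReal L := by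
    refine le_antisymm ?_ hlow
    have := hle 1
    rwa [← hrange, Icc.coe_one, one_mul] at this
  have hd : intrinsicDist q x y = ENNReal.ofReal L :=
    le_antisymm ((iInf₂_le γ hγS).trans hlen.le)
      (le_iInf₂ fun γ' hγ' => ofReal_gdist_le_hausdorffMeasure_range hq γ' hγ')
  refine ⟨hd, γ, hγS, hlen.trans hd.symm, fun t => ?_⟩
  rw [hlen, ← ENNReal.ofReal_mul t.2.1]
  refine le_antisymm (hle t) ?_
  -- Both parts of the path obey upper bounds that add up to `L`, while the whole has length at
  -- least `L`; so both bounds are equalities.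
  have hrest : Measure.hausdorffMeasure 1 (γ '' Icc t 1) ≤ ENNReal.ofReal (L - t * L) := by
    refine (measure_mono ?_).trans (hausdorffMeasure_image_Icc_le hf (t * L) L)
    rintro _ ⟨u, hu, rfl⟩
    exact ⟨u * L, ⟨mul_le_mul_of_nonneg_right hu.1 h0, mul_le_of_le_one_left h0 u.2.2⟩, rfl⟩
  have hsum : ENNReal.ofReal (t * L) + ENNReal.ofReal (L - t * L) ≤
      Measure.hausdorffMeasure 1 (γ '' Icc 0 t) + ENNReal.ofReal (L - t * L) := by
    rw [← ENNReal.ofReal_add (mul_nonneg t.2.1 h0)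
      (sub_nonneg.2 (mul_le_of_le_one_left h0 t.2.2)), add_sub_cancel]
    refine hlow.trans ?_
    rw [hrange, ← Icc_union_Icc_eq_Icc (b := t) t.2.1 t.2.2, image_union]
    exact (measure_union_le _ _).trans (add_le_add le_rfl hrest)
  exact (ENNReal.add_le_add_iff_right ENNReal.ofReal_ne_top).1 hsum

theorem IsGeodesic.pathLength_eq (hq : IsUnitSimplex q) {x y : E n} {g : Path x y}
    (hg : IsGeodesic q g) : pathLength g = ENNReal.ofReal (gdist q x y) := by
  have hx : x ∈ gasket q := hg.subset ⟨0, g.source⟩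
  have hy : y ∈ gasket q := hg.subset ⟨1, g.target⟩
  rw [hg.length_eq, (exists_isGeodesic_and_intrinsicDist_eq hq hx hy).1]

theorem gdist_pos (hq : IsUnitSimplex q) {x y : E n} (hx : x ∈ gasket q) (hy : y ∈ gasket q)
    (hxy : x ≠ y) : 0 < gdist q x y :=
  (dist_pos.2 hxy).trans_le (dist_le_gdist hq hx hy)

/-- Cutting out a loop of a path does not make it shorter than the distance of its end points. -/
theorem ofReal_gdist_le_of_loop (hq : IsUnitSimplex q) {x y : E n} (g : Path x y)
    (hg : range g ⊆ gasket q) {u v : I} (huv : g u = g v) :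
    ENNReal.ofReal (gdist q x y) ≤
      Measure.hausdorffMeasure 1 (g '' Icc 0 u ∪ g '' Icc v 1) := by
  let p : Path x y := ((g.subpath 0 u).cast g.source.symm rfl).trans
    ((g.subpath v 1).cast huv g.target.symm)
  have hp : range p = g '' Icc 0 u ∪ g '' Icc v 1 := by
    rw [Path.trans_range, Path.cast_coe, Path.cast_coe,
      Path.range_subpath_of_le g 0 u u.2.1, Path.range_subpath_of_le g v 1 v.2.2]
  rw [← hp]
  refine ofReal_gdist_le_hausdorffMeasure_range hq p ?_
  rw [hp]
  exact union_subset ((image_subset_range _ _).trans hg) ((image_subset_range _ _).trans hg)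

theorem isClosed_path_image_Icc {x y : E n} (g : Path x y) (s t : I) :
    IsClosed (g '' Icc s t) :=
  (isCompact_Icc.image g.continuous).isClosed

/-- Following `g` up to `p` and then from `v` on is still a path from `x` to `y`, so it already has
the full length. The part of `g([p, p'])` off this shortcut is therefore null, `H¹(g([0, ·]))` does
not grow from `p` to `p'`, and constant speed forces `p = p'`. -/
theorem IsGeodesic.eq_of_loop (hq : IsUnitSimplex q) {x y : E n} (hxy : x ≠ y) {g : Path x y}
    (hg : IsGeodesic q g) {p p' v : I} (hpp : p ≤ p') (hpv : g p = g v)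
    (hdisj : ∀ r, v < r → g r ∉ g '' Icc p p') : p = p' := by
  have := Measure.nullSingletonClass_hausdorff (E n) (d := 1) one_pos
  have hD0 := gdist_pos hq (hg.subset ⟨0, g.source⟩) (hg.subset ⟨1, g.target⟩) hxy
  have hlen := hg.pathLength_eq hq
  set D := gdist q x y with hD
  set M := g '' Icc p p' \ (g '' Icc 0 p ∪ {g v}) with hM
  have hMm : MeasurableSet M := (isClosed_path_image_Icc g p p').measurableSet.diff
    ((isClosed_path_image_Icc g 0 p).union isClosed_singleton).measurableSet
  have hMdisj : Disjoint (g '' Icc 0 p ∪ g '' Icc v 1) M := by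
    rw [Set.disjoint_left]
    rintro z (hz | ⟨r, hr, rfl⟩) ⟨hz1, hz2⟩
    · exact hz2 (Or.inl hz)
    · rcases hr.1.eq_or_lt with rfl | hvr
      · exact hz2 (Or.inr rfl)
      · exact hdisj r hvr hz1
  have h1 : Measure.hausdorffMeasure 1 M = 0 := by
    have h2 : ENNReal.ofReal D + Measure.hausdorffMeasure 1 M ≤ ENNReal.ofReal D + 0 := by
      rw [add_zero]
      calc _ ≤ Measure.hausdorffMeasure 1 (g '' Icc 0 p ∪ g '' Icc v 1) +
            Measure.hausdorffMeasure 1 M :=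
            add_le_add_left (ofReal_gdist_le_of_loop hq g hg.subset hpv) _
        _ = Measure.hausdorffMeasure 1 ((g '' Icc 0 p ∪ g '' Icc v 1) ∪ M) :=
            (measure_union hMdisj hMm).symm
        _ ≤ pathLength g := measure_mono (union_subset (union_subset (image_subset_range _ _)
            (image_subset_range _ _)) (sdiff_subset.trans (image_subset_range _ _)))
        _ = _ := hlen
    exact le_antisymm ((ENNReal.add_le_add_iff_left ENNReal.ofReal_ne_top).1 h2) zero_le
  have h2 : Measure.hausdorffMeasure 1 (g '' Icc 0 p') ≤
      Measure.hausdorffMeasure 1 (g '' Icc 0 p) := by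
    have hsub : g '' Icc 0 p' ⊆ g '' Icc 0 p ∪ (M ∪ {g v}) := by
      rw [← Icc_union_Icc_eq_Icc (b := p) p.2.1 hpp, image_union]
      refine union_subset subset_union_left fun z hz => ?_
      by_cases hz1 : z ∈ g '' Icc 0 p
      · exact Or.inl hz1
      by_cases hz2 : z = g v
      · exact Or.inr (Or.inr hz2)
      · exact Or.inr (Or.inl ⟨hz, fun h => h.elim hz1 hz2⟩)
    refine (measure_mono hsub).trans ((measure_union_le _ _).trans ?_)
    rw [measure_union_null h1 (measure_singleton _), add_zero]
  rw [hg.constant_speed, hg.constant_speed, hlen, ← ENNReal.ofReal_mul p'.2.1,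
    ← ENNReal.ofReal_mul p.2.1, ENNReal.ofReal_le_ofReal_iff (mul_nonneg p.2.1 hD0.le)] at h2
  exact le_antisymm hpp (Subtype.coe_le_coe.1 (le_of_mul_le_mul_right h2 hD0))

theorem IsGeodesic.injective (hq : IsUnitSimplex q) {x y : E n} (hxy : x ≠ y) {g : Path x y}
    (hg : IsGeodesic q g) : Function.Injective g := by
  suffices h : ∀ s s' : I, s < s' → g s ≠ g s' by
    intro s s' hss
    rcases lt_trichotomy s s' with h1 | h1 | h1
    · exact absurd hss (h s s' h1)
    · exact h1
    · exact absurd hss.symm (h s' s h1)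
  intro s s' hss heq
  -- Let `v` be the last time at which the path is in `g([s, s'])`, say at `g u`. Cutting from `u`
  -- to `v` yields `u = s'`; then `g v = g s' = g s`, and cutting from `s` to `v` yields `s = s'`.
  obtain ⟨v, ⟨hv, u, hu, huv⟩, hmax⟩ := IsCompact.exists_isGreatest
    (s := Icc s' 1 ∩ g ⁻¹' (g '' Icc s s'))
    (isCompact_Icc.inter_right ((isClosed_path_image_Icc g s s').preimage g.continuous))
    ⟨s', ⟨le_rfl, s'.2.2⟩, mem_image_of_mem g ⟨hss.le, le_rfl⟩⟩
  have hdisj : ∀ r, v < r → g r ∉ g '' Icc s s' := fun r hr h =>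
    hr.not_ge (hmax ⟨⟨hv.1.trans hr.le, r.2.2⟩, h⟩)
  have hus : u = s' := hg.eq_of_loop hq hxy hu.2 huv fun r hr h =>
    hdisj r hr (image_mono (Icc_subset_Icc_left hu.1) h)
  rw [hus, ← heq] at huv
  exact hss.ne (hg.eq_of_loop hq hxy hss.le huv hdisj)

theorem IsGeodesic.hausdorffMeasure_image_Icc (hq : IsUnitSimplex q) {x y : E n} (hxy : x ≠ y)
    {g : Path x y} (hg : IsGeodesic q g) {s t : I} (hst : s ≤ t) :
    Measure.hausdorffMeasure 1 (g '' Icc s t) = ENNReal.ofReal ((t - s) * gdist q x y) := by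
  have := Measure.nullSingletonClass_hausdorff (E n) (d := 1) one_pos
  have hlen := hg.pathLength_eq hq
  have h0 := gdist_nonneg (q := q) x y
  have h1 : Measure.hausdorffMeasure 1 (g '' Icc 0 t) =
      Measure.hausdorffMeasure 1 (g '' Icc 0 s) + Measure.hausdorffMeasure 1 (g '' Icc s t) := by
    rw [← Icc_union_Icc_eq_Icc (b := s) s.2.1 hst, image_union]
    refine measure_union₀ (isClosed_path_image_Icc g s t).measurableSet.nullMeasurableSet ?_
    refine measure_mono_null ?_ (measure_singleton (g s))
    rw [← image_inter (hg.injective hq hxy), Icc_inter_Icc_eq_singleton (show (0 : I) ≤ s from s.2.1) hst,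
      image_singleton]
  rw [hg.constant_speed, hg.constant_speed, hlen, ← ENNReal.ofReal_mul t.2.1,
    ← ENNReal.ofReal_mul s.2.1] at h1
  have hst' : (0 : ℝ) ≤ t - s := sub_nonneg.2 hst
  have h2 : ENNReal.ofReal (s * gdist q x y) + ENNReal.ofReal ((t - s) * gdist q x y) =
      ENNReal.ofReal (t * gdist q x y) := by
    rw [← ENNReal.ofReal_add (mul_nonneg s.2.1 h0) (mul_nonneg hst' h0)]
    congr 1
    ring
  exact ((ENNReal.add_right_inj ENNReal.ofReal_ne_top).1 (h2.trans h1)).symm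

theorem IsGeodesic.gdist_le_mul (hq : IsUnitSimplex q) {x y : E n} (hxy : x ≠ y)
    {g : Path x y} (hg : IsGeodesic q g) {s t : I} (hst : s ≤ t) :
    gdist q (g s) (g t) ≤ (t - s) * gdist q x y := by
  have h := ofReal_gdist_le_hausdorffMeasure_range hq (g.subpath s t)
    (by rw [Path.range_subpath_of_le g s t hst]; exact (image_subset_range _ _).trans hg.subset)
  rw [Path.range_subpath_of_le g s t hst, hg.hausdorffMeasure_image_Icc hq hxy hst] at h
  exact (ENNReal.ofReal_le_ofReal_iff (mul_nonneg (sub_nonneg.2 hst) (gdist_nonneg x y))).1 h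

/-- The upper bounds on `[0, s]`, `[s, t]` and `[t, 1]` add up to the distance of the end points, so
by the triangle inequality none is strict. -/
theorem IsGeodesic.gdist_eq_mul (hq : IsUnitSimplex q) {x y : E n} (hxy : x ≠ y)
    {g : Path x y} (hg : IsGeodesic q g) {s t : I} (hst : s ≤ t) :
    gdist q (g s) (g t) = (t - s) * gdist q x y := by
  refine le_antisymm (hg.gdist_le_mul hq hxy hst) ?_
  have hS : ∀ r, g r ∈ gasket q := fun r => hg.subset (mem_range_self r)
  have h1 := hg.gdist_le_mul hq hxy (show (0 : I) ≤ s from s.2.1)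
  have h2 := hg.gdist_le_mul hq hxy (show t ≤ (1 : I) from t.2.2)
  have h3 := gdist_triangle hq (hS 0) (hS s) (hS 1)
  have h4 := gdist_triangle hq (hS s) (hS t) (hS 1)
  simp only [g.source, g.target, Icc.coe_zero, Icc.coe_one] at h1 h2 h3 h4
  linarith

/-- The final part of a geodesic is a geodesic. -/
theorem IsGeodesic.subpath_one (hq : IsUnitSimplex q) {x y : E n} (hxy : x ≠ y)
    {g : Path x y} (hg : IsGeodesic q g) (s : I) {z : E n} (hz : z = g s) :
    IsGeodesic q ((g.subpath s 1).cast hz g.target.symm) := by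
  subst hz
  have hS : ∀ r, g r ∈ gasket q := fun r => hg.subset (mem_range_self r)
  have hy : y ∈ gasket q := hg.subset ⟨1, g.target⟩
  have hs1 : (0 : ℝ) ≤ 1 - s := sub_nonneg.2 s.2.2
  have hd : gdist q (g s) y = (1 - s) * gdist q x y := by
    have := hg.gdist_eq_mul hq hxy (show s ≤ (1 : I) from s.2.2)
    rwa [g.target] at this
  have hlen : pathLength ((g.subpath s 1).cast rfl g.target.symm) =
      ENNReal.ofReal ((1 - s) * gdist q x y) := by
    rw [pathLength, Path.cast_coe, Path.range_subpath_of_le g s 1 s.2.2,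
      hg.hausdorffMeasure_image_Icc hq hxy (show s ≤ (1 : I) from s.2.2)]
    rfl
  refine ⟨?_, ?_, fun t => ?_⟩
  · rw [Path.cast_coe, Path.range_subpath_of_le g s 1 s.2.2]
    exact (image_subset_range _ _).trans hg.subset
  · rw [hlen, (exists_isGeodesic_and_intrinsicDist_eq hq (hS s) hy).1, hd]
  · have hcc : ∀ u : I, ((Icc.convexComb s 1 u : I) : ℝ) = s + u * (1 - s) := fun u => by
      rw [Icc.coe_convexComb, Icc.coe_one]
      ring
    have himg : Icc.convexComb s 1 '' Icc 0 t = Icc s (Icc.convexComb s 1 t) := by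
      ext r
      constructor
      · rintro ⟨u, hu, rfl⟩
        constructor
        · rw [← Subtype.coe_le_coe, hcc]
          nlinarith [u.2.1]
        · rw [← Subtype.coe_le_coe, hcc, hcc]
          have : (u : ℝ) ≤ t := hu.2
          nlinarith
      · rintro ⟨hr1, hr2⟩
        rw [← Subtype.coe_le_coe] at hr1 hr2
        rw [hcc] at hr2
        rcases hs1.eq_or_lt with h | h
        · refine ⟨t, ⟨t.2.1, le_rfl⟩, Subtype.ext ?_⟩
          rw [hcc]
          have := r.2.2
          nlinarith [t.2.1]
        · have ht : (r - s : ℝ) / (1 - s) ≤ t := by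
            rw [div_le_iff₀ h]
            linarith
          have ht0 : 0 ≤ (r - s : ℝ) / (1 - s) := div_nonneg (by linarith) h.le
          refine ⟨⟨(r - s) / (1 - s), ht0, ht.trans t.2.2⟩, ⟨ht0, ht⟩, Subtype.ext ?_⟩
          rw [hcc]
          dsimp only
          rw [div_mul_cancel₀ _ h.ne']
          ring
    have hs_le : s ≤ Icc.convexComb s 1 t := by
      rw [← Subtype.coe_le_coe, hcc]
      nlinarith [t.2.1]
    rw [hlen, Path.cast_coe, show (g.subpath s 1 : I → E n) = g ∘ Icc.convexComb s 1 from rfl,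
      image_comp, himg, hg.hausdorffMeasure_image_Icc hq hxy hs_le, hcc,
      ← ENNReal.ofReal_mul t.2.1]
    congr 1
    ring

end Geodesics

/-! ### Invariance under permutations of the letters. -/

section Symmetry

variable {n : ℕ} (q : AffineBasis (Fin (n + 1)) ℝ (E n))

theorem coord_address (k : Fin (n + 1)) (s : ℕ → Fin (n + 1)) :
    q.coord k (address q s) =
      (1 / 2) * (q.coord k (address q fun j => s (j + 1)) + if k = s 0 then 1 else 0) := by
  rw [← coord_F, ← address_consAddr]
  congr 2
  funext j
  cases j <;> rfl

/-- Removing the first letter halves the difference of the two sides, so that difference is at most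
`2⁻ᵐ` for every `m`. -/
theorem coord_address_comp_perm (τ : Equiv.Perm (Fin (n + 1))) (k : Fin (n + 1))
    (s : ℕ → Fin (n + 1)) :
    q.coord (τ k) (address q fun j => τ (s j)) = q.coord k (address q s) := by
  have key : ∀ m : ℕ, ∀ s : ℕ → Fin (n + 1),
      |q.coord (τ k) (address q fun j => τ (s j)) - q.coord k (address q s)| ≤ (1 / 2) ^ m := by
    intro m
    induction m with
    | zero =>
      intro s
      rw [pow_zero, abs_le]
      have h1 := coord_nonneg q k (mem_range_self s)
      have h2 := coord_le_one q k (mem_range_self s)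
      have h3 := coord_nonneg q (τ k) (mem_range_self fun j => τ (s j))
      have h4 := coord_le_one q (τ k) (mem_range_self fun j => τ (s j))
      constructor <;> linarith
    | succ m ih =>
      intro s
      rw [coord_address, coord_address q k]
      simp only [τ.injective.eq_iff]
      rw [← mul_sub, add_sub_add_right_eq_sub, abs_mul, pow_succ', abs_of_pos (by norm_num)]
      exact mul_le_mul_of_nonneg_left (ih _) (by norm_num)
  have hlim := tendsto_pow_atTop_nhds_zero_of_lt_one (r := (1 / 2 : ℝ)) (by norm_num) (by norm_num)
  exact sub_eq_zero.1 (abs_eq_zero.1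
    (le_antisymm (ge_of_tendsto' hlim fun m => key m s) (abs_nonneg _)))

theorem map_perm_uniformOn (τ : Equiv.Perm (Fin (n + 1))) :
    (ProbabilityTheory.uniformOn (univ : Set (Fin (n + 1)))).map τ =
      ProbabilityTheory.uniformOn univ := by
  ext s hs
  rw [Measure.map_apply measurable_from_top hs, ProbabilityTheory.uniformOn_univ,
    ProbabilityTheory.uniformOn_univ, ← τ.image_symm_eq_preimage,
    Measure.count_injective_image τ.symm.injective]

/-- All the barycentric coordinates have the same law. -/
theorem map_coord_stdMeasure (k : Fin (n + 1)) : (stdMeasure q).map (q.coord k) = nu q := by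
  set τ : Equiv.Perm (Fin (n + 1)) := Equiv.swap k 0 with hτ
  have ha := (continuous_address q).measurable
  have hP : (Measure.infinitePi fun _ : ℕ =>
      ProbabilityTheory.uniformOn (univ : Set (Fin (n + 1)))).map (fun s j => τ (s j)) =
      Measure.infinitePi fun _ : ℕ => ProbabilityTheory.uniformOn univ := by
    rw [Measure.infinitePi_map_pi (f := fun _ => τ) _ fun _ => measurable_from_top]
    simp only [map_perm_uniformOn]
  have hτm : Measurable fun (s : ℕ → Fin (n + 1)) j => τ (s j) :=
    measurable_pi_iff.2 fun j => measurable_from_top.comp (measurable_pi_apply j)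
  rw [nu, stdMeasure, Measure.map_map (continuous_coord q k).measurable ha,
    Measure.map_map (continuous_coord q 0).measurable ha]
  conv_rhs => rw [← hP]
  rw [Measure.map_map ((continuous_coord q 0).measurable.comp ha) hτm]
  congr 1
  funext s
  have h := coord_address_comp_perm q τ k s
  rw [hτ, Equiv.swap_apply_left] at h
  exact h.symm

end Symmetry

/-! ### The interpolant as an affine function of a barycentric coordinate. -/

section Interpolation

variable {n : ℕ} {q : AffineBasis (Fin (n + 1)) ℝ (E n)}

theorem cellVertex_ne_of_notMem_cell {w : List (Fin (n + 1))} (i : Fin (n + 1)) {b : E n}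
    (hbA : b ∉ cell q w) : cellVertex q w i ≠ b :=
  fun h => hbA (h ▸ cellVertex_mem_cell q w i)

/-- A geodesic from the cell to `b` consists of a geodesic to the vertex, followed by the common
path. -/
theorem exists_entry_time (hq : IsUnitSimplex q) {w : List (Fin (n + 1))} {i : Fin (n + 1)}
    {b : E n} (hbA : b ∉ cell q w) {γ : Path (cellVertex q w i) b}
    (huniq : ∀ γ' : Path (cellVertex q w i) b, IsGeodesic q γ' → γ' = γ)
    (hpass : ∀ a ∈ cell q w, ∀ g : Path a b, IsGeodesic q g → cellVertex q w i ∈ range g)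
    {x : E n} (hx : x ∈ gasket q) {g : Path (wordMap q w x) b} (hg : IsGeodesic q g) :
    ∃ s : I, (∀ u, g (Icc.convexComb s 1 u) = γ u) ∧
      s * gdist q (wordMap q w x) b = (1 / 2) ^ w.length * (1 - q.coord i x) ∧
      (1 - s) * gdist q (wordMap q w x) b = gdist q (cellVertex q w i) b := by
  have ha : wordMap q w x ∈ cell q w := mem_image_of_mem _ hx
  have hab : wordMap q w x ≠ b := fun h => hbA (h ▸ ha)
  obtain ⟨s, hs⟩ := hpass _ ha g hg
  refine ⟨s, fun u => ?_, ?_, ?_⟩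
  · rw [← huniq _ (hg.subpath_one hq hab s hs.symm)]
    rfl
  · rw [← gdist_vertex hq w i hx, ← hs]
    have := hg.gdist_eq_mul hq hab (show (0 : I) ≤ s from s.2.1)
    rw [g.source, Icc.coe_zero, sub_zero] at this
    exact this.symm
  · rw [← hs]
    have := hg.gdist_eq_mul hq hab (show s ≤ (1 : I) from s.2.2)
    rw [g.target, Icc.coe_one] at this
    exact this.symm

theorem isPart_of_convexComb {x y a b : E n} {γ : Path x y} {g : Path a b} {s : I}
    (h : ∀ u, g (Icc.convexComb s 1 u) = γ u) : IsPart γ g s 1 := by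
  refine ⟨s.2.2, ?_⟩
  rw [← Path.range_subpath_of_le g s 1 s.2.2]
  congr 1
  funext u
  exact h u

/-- The interpolant in closed form. -/
theorem exists_Z_eq (hq : IsUnitSimplex q) {w : List (Fin (n + 1))} {i : Fin (n + 1)}
    {b : E n} (hb : b ∈ gasket q) (hbA : b ∉ cell q w) {γ : Path (cellVertex q w i) b}
    (huniq : ∀ γ' : Path (cellVertex q w i) b, IsGeodesic q γ' → γ' = γ)
    (hpass : ∀ a ∈ cell q w, ∀ g : Path a b, IsGeodesic q g → cellVertex q w i ∈ range g)
    {t : I} (ht : finalEntryTime q γ (cell q w) {b} ≤ t) {x : E n} (hx : x ∈ gasket q) :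
    ∃ r : I, Z q γ t (wordMap q w x) b = γ r ∧ (r : ℝ) =
      t - (1 - t) * (1 / 2) ^ w.length / gdist q (cellVertex q w i) b * (1 - q.coord i x) := by
  have ha : wordMap q w x ∈ cell q w := mem_image_of_mem _ hx
  have hex : ∃ g : Path (wordMap q w x) b, IsGeodesic q g ∧ ∃ t₁ t₂ : I, IsPart γ g t₁ t₂ := by
    obtain ⟨g, hg⟩ := (exists_isGeodesic_and_intrinsicDist_eq hq
      (cell_subset_gasket q w ha) hb).2
    obtain ⟨s, hs, -⟩ := exists_entry_time hq hbA huniq hpass hx hg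
    exact ⟨g, hg, s, 1, isPart_of_convexComb hs⟩
  have hZ : Z q γ t (wordMap q w x) b = hex.choose t := by
    rw [Z, dif_pos hex]
  have hg := hex.choose_spec.1
  rw [hZ]
  -- Only the fact that `g` is a geodesic matters: the formula below does not depend on which
  -- geodesic was chosen.
  generalize hex.choose = g at hg
  obtain ⟨s, hs, hs1, hs2⟩ := exists_entry_time hq hbA huniq hpass hx hg
  have hst : (s : ℝ) ≤ t := by
    refine le_trans (le_csSup ⟨1, ?_⟩ ?_) ht
    · rintro _ ⟨-, -, -, -, -, -, t₁, -, -, rfl⟩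
      exact t₁.2.2
    · exact ⟨_, ha, b, rfl, g, hg, s, 1, isPart_of_convexComb hs, rfl⟩
  have hL := gdist_pos hq (cell_subset_gasket q w (cellVertex_mem_cell q w i)) hb
    (cellVertex_ne_of_notMem_cell i hbA)
  set D := gdist q (wordMap q w x) b
  set L := gdist q (cellVertex q w i) b
  have hD : 0 ≤ D := gdist_nonneg _ _
  have h1s : (0 : ℝ) < 1 - s := by
    refine (sub_nonneg.2 s.2.2).lt_of_ne fun h => ?_
    rw [← h, zero_mul] at hs2
    exact hL.ne hs2
  -- The parameter on `γ` solves `s + r (1 - s) = t`.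
  have hr0 : 0 ≤ ((t : ℝ) - s) / (1 - s) := div_nonneg (sub_nonneg.2 hst) h1s.le
  have hr1 : ((t : ℝ) - s) / (1 - s) ≤ 1 := by
    rw [div_le_one h1s]
    linarith [t.2.2]
  refine ⟨⟨_, hr0, hr1⟩, ?_, ?_⟩
  · rw [← hs]
    congr 1
    apply Subtype.ext
    rw [Icc.coe_convexComb, Icc.coe_one]
    dsimp only
    field_simp
    ring
  · have hD0 : D ≠ 0 := by
      rintro h
      rw [h, mul_zero] at hs2
      exact hL.ne hs2
    dsimp only
    have : (1 - (t : ℝ)) * (1 / 2) ^ w.length / L * (1 - q.coord i x) =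
        (1 - t) * (s * D) / L := by
      rw [hs1]
      ring
    rw [this, ← hs2]
    field_simp
    ring

theorem one_le_of_notMem_cell {w : List (Fin (n + 1))} {b : E n} (hbA : b ∉ cell q w) :
    1 ≤ n := by
  by_contra hn
  obtain rfl : n = 0 := by omega
  exact hbA (Subsingleton.elim (cellVertex q w 0) b ▸ cellVertex_mem_cell q w 0)

/-- The largest parameter `t` is attained at the entry vertex, where `[x]_i = 1`, and the smallest
at any other vertex of the cell, where `[x]_i = 0`. Injectivity of `γ` makes the parameter of a
point unambiguous. -/
theorem H_eq (hq : IsUnitSimplex q) {w : List (Fin (n + 1))} {i : Fin (n + 1)}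
    {b : E n} (hb : b ∈ gasket q) (hbA : b ∉ cell q w) {γ : Path (cellVertex q w i) b}
    (hγ : IsGeodesic q γ)
    (huniq : ∀ γ' : Path (cellVertex q w i) b, IsGeodesic q γ' → γ' = γ)
    (hpass : ∀ a ∈ cell q w, ∀ g : Path a b, IsGeodesic q g → cellVertex q w i ∈ range g)
    {t : I} (ht : finalEntryTime q γ (cell q w) {b} ≤ t) (u : ℝ) :
    H q γ t (cell q w) b u = γ.extend
      (t - (1 - t) * (1 / 2) ^ w.length / gdist q (cellVertex q w i) b * (1 - u)) := by
  have hvb := cellVertex_ne_of_notMem_cell i hbA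
  have hL := gdist_pos hq (cell_subset_gasket q w (cellVertex_mem_cell q w i)) hb hvb
  set lam := (1 - (t : ℝ)) * (1 / 2) ^ w.length / gdist q (cellVertex q w i) b with hlam
  have hlam0 : 0 ≤ lam := div_nonneg (mul_nonneg (sub_nonneg.2 t.2.2) (by positivity)) hL.le
  have hmem : ∀ x ∈ gasket q, (t - lam * (1 - q.coord i x) : ℝ) ∈
      interpInterval q γ t (cell q w) b := by
    intro x hx
    obtain ⟨r, hr, hr'⟩ := exists_Z_eq hq hb hbA huniq hpass ht hx
    exact ⟨r, hr'.symm, _, mem_image_of_mem _ hx, hr⟩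
  have hsub : ∀ s ∈ interpInterval q γ t (cell q w) b, ∃ x ∈ gasket q,
      s = t - lam * (1 - q.coord i x) := by
    rintro _ ⟨r, rfl, _, ⟨x, hx, rfl⟩, hr⟩
    obtain ⟨r', hr', hr''⟩ := exists_Z_eq hq hb hbA huniq hpass ht hx
    refine ⟨x, hx, ?_⟩
    rw [← hr'']
    exact congrArg _ (hγ.injective hq hvb (hr.symm.trans hr'))
  have hsup : sSup (interpInterval q γ t (cell q w) b) = t := by
    refine IsGreatest.csSup_eq ⟨?_, ?_⟩
    · simpa using hmem (q i) (vertex_mem_gasket q i)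
    · intro s hs
      obtain ⟨x, hx, rfl⟩ := hsub s hs
      have := mul_nonneg hlam0 (sub_nonneg.2 (coord_le_one q i hx))
      linarith
  have hinf : sInf (interpInterval q γ t (cell q w) b) = t - lam := by
    refine IsLeast.csInf_eq ⟨?_, ?_⟩
    · have : Nontrivial (Fin (n + 1)) :=
        Fin.nontrivial_iff_two_le.2 (by have := one_le_of_notMem_cell hbA; omega)
      obtain ⟨j, hj⟩ := exists_ne i
      simpa [AffineBasis.coord_apply, hj.symm] using hmem (q j) (vertex_mem_gasket q j)
    · intro s hs
      obtain ⟨x, hx, rfl⟩ := hsub s hs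
      have := mul_nonneg hlam0 (coord_nonneg q i hx)
      linarith
  rw [H, hsup, hinf]
  congr 1
  ring

theorem Z_eq_H (hq : IsUnitSimplex q) {w : List (Fin (n + 1))} {i : Fin (n + 1)}
    {b : E n} (hb : b ∈ gasket q) (hbA : b ∉ cell q w) {γ : Path (cellVertex q w i) b}
    (hγ : IsGeodesic q γ)
    (huniq : ∀ γ' : Path (cellVertex q w i) b, IsGeodesic q γ' → γ' = γ)
    (hpass : ∀ a ∈ cell q w, ∀ g : Path a b, IsGeodesic q g → cellVertex q w i ∈ range g)
    {t : I} (ht : finalEntryTime q γ (cell q w) {b} ≤ t) {x : E n} (hx : x ∈ gasket q) :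
    Z q γ t (wordMap q w x) b = H q γ t (cell q w) b (q.coord i x) := by
  obtain ⟨r, hr, hr'⟩ := exists_Z_eq hq hb hbA huniq hpass ht hx
  rw [H_eq hq hb hbA hγ huniq hpass ht, ← hr', hr, Path.extend_extends']

theorem continuous_H {x y : E n} (γ : Path x y) (t : I) (A : Set (E n)) (b : E n) :
    Continuous (H q γ t A b) :=
  γ.continuous_extend.comp (by fun_prop)

theorem eta_eq (hq : IsUnitSimplex q) {w : List (Fin (n + 1))} {i : Fin (n + 1)}
    {b : E n} (hb : b ∈ gasket q) (hbA : b ∉ cell q w) {γ : Path (cellVertex q w i) b}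
    (hγ : IsGeodesic q γ)
    (huniq : ∀ γ' : Path (cellVertex q w i) b, IsGeodesic q γ' → γ' = γ)
    (hpass : ∀ a ∈ cell q w, ∀ g : Path a b, IsGeodesic q g → cellVertex q w i ∈ range g)
    {t : I} (ht : finalEntryTime q γ (cell q w) {b} ≤ t) :
    eta q γ t (cell q w) b =
      (((n : ℝ≥0∞) + 1)⁻¹ ^ w.length) • (nu q).map (H q γ t (cell q w) b) := by
  have hHm : Measurable (H q γ t (cell q w) b) := (continuous_H γ t _ b).measurable
  have hcm : Measurable (q.coord i) := (continuous_coord q i).measurable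
  -- `Z` is defined by choice, so its measurability is not evident. `G` is a measurable function on
  -- the whole space that agrees with it on the cell; the argument of `H` recovers `[x]_i` from the
  -- `i`-th coordinate of `z = F_w(x)`.
  set G : E n → E n := fun z =>
    H q γ t (cell q w) b (2 ^ w.length * q.coord i z - corner w i) with hG
  have hGm : Measurable G := hHm.comp ((hcm.const_mul _).sub_const _)
  have hGw : ∀ x, G (wordMap q w x) = H q γ t (cell q w) b (q.coord i x) := by
    intro x
    rw [hG]
    dsimp only
    have h2 : (2 : ℝ) ^ w.length * (1 / 2) ^ w.length = 1 := by
      rw [← mul_pow]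
      norm_num
    rw [coord_wordMap, ← mul_assoc, h2]
    congr 1
    ring
  have hZG : (fun a => Z q γ t a b) =ᵐ[(stdMeasure q).restrict (cell q w)] G := by
    filter_upwards [ae_restrict_mem (isCompact_cell q w).isClosed.measurableSet] with a ha
    obtain ⟨x, hx, rfl⟩ := ha
    rw [hGw]
    exact Z_eq_H hq hb hbA hγ huniq hpass ht hx
  rw [eta, Measure.map_congr hZG, stdMeasure_restrict_cell q (one_le_of_notMem_cell hbA),
    Measure.map_smul, Measure.map_map hGm (continuous_wordMap q w).measurable,
    ← map_coord_stdMeasure q i, Measure.map_map hHm hcm]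
  congr 2
  funext x
  exact hGw x

end Interpolation

/-! ### Binary digits and the law of large numbers. -/

section Coding

/-- The law of a sequence of independent uniformly distributed letters. -/
abbrev letterMeasure (n : ℕ) : Measure (ℕ → Fin (n + 1)) :=
  Measure.infinitePi fun _ : ℕ => ProbabilityTheory.uniformOn (univ : Set (Fin (n + 1)))

/-- The integer whose binary digits record the occurrences of the letter `0` in the first `m`
letters. -/
def binaryPrefix {n : ℕ} : ℕ → (ℕ → Fin (n + 1)) → ℕ
  | 0, _ => 0
  | m + 1, s => 2 * binaryPrefix m s + if s m = 0 then 1 else 0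

/-- The logarithm of the probability that a letter is `0`, respectively is not `0`. -/
def logProb {n : ℕ} (i : Fin (n + 1)) : ℝ :=
  if i = 0 then Real.log (1 / (n + 1)) else Real.log (n / (n + 1))

variable {n : ℕ}

/-- The `j`-th binary digit of `[x]_0` is `1` exactly when the `j`-th letter is `0`; the coordinate
of the shifted address, in `[0, 1]`, is the remainder. -/
theorem coord_zero_address (q : AffineBasis (Fin (n + 1)) ℝ (E n)) (m : ℕ)
    (s : ℕ → Fin (n + 1)) :
    q.coord 0 (address q s) =
      (1 / 2) ^ m * (binaryPrefix m s + q.coord 0 (address q fun j => s (j + m))) := by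
  induction m with
  | zero => simp [binaryPrefix]
  | succ m ih =>
    rw [ih, coord_address q 0 fun j => s (j + m), binaryPrefix]
    simp only [zero_add, eq_comm (a := (0 : Fin (n + 1))), add_assoc, add_comm 1 m]
    push_cast
    ring

theorem measurable_binaryPrefix (m : ℕ) :
    Measurable fun s : ℕ → Fin (n + 1) => binaryPrefix m s := by
  induction m with
  | zero => exact measurable_const
  | succ m ih =>
    have h : Measurable fun s : ℕ → Fin (n + 1) => if s m = 0 then 1 else 0 :=
      (measurable_from_top (f := fun i : Fin (n + 1) => if i = 0 then (1 : ℕ) else 0)).comp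
        (measurable_pi_apply m)
    exact (ih.const_mul 2).add h

theorem binaryPrefix_eq_iff (m : ℕ) (s s' : ℕ → Fin (n + 1)) :
    binaryPrefix m s = binaryPrefix m s' ↔ ∀ j < m, (s j = 0 ↔ s' j = 0) := by
  induction m with
  | zero => simp [binaryPrefix]
  | succ m ih =>
    rw [Nat.forall_lt_succ_right, ← ih, binaryPrefix, binaryPrefix]
    by_cases h : s m = 0 <;> by_cases h' : s' m = 0 <;> simp only [h, h', if_true, if_false] <;>
      grind

theorem uniformOn_iff_eq (hn : 1 ≤ n) (i : Fin (n + 1)) :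
    ProbabilityTheory.uniformOn (univ : Set (Fin (n + 1))) {j | j = 0 ↔ i = 0} =
      ENNReal.ofReal (Real.exp (logProb i)) := by
  have hn' : (0 : ℝ) < n := by exact_mod_cast hn
  have h0 : ProbabilityTheory.uniformOn (univ : Set (Fin (n + 1))) {0} =
      ENNReal.ofReal (1 / (n + 1)) := by
    rw [ProbabilityTheory.uniformOn_univ, Measure.count_singleton, Fintype.card_fin,
      ENNReal.ofReal_div_of_pos (by positivity), ENNReal.ofReal_one]
    congr 1
    rw [← Nat.cast_succ, ENNReal.ofReal_natCast]
  rw [logProb]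
  split_ifs with hi
  · rw [Real.exp_log (by positivity), ← h0]
    congr 1
    ext j
    simp [hi]
  · have h1 : {j : Fin (n + 1) | j = 0 ↔ i = 0} = {0}ᶜ := by
      ext j
      simp [hi]
    rw [h1, prob_compl_eq_one_sub (measurableSet_singleton _), h0, Real.exp_log (by positivity),
      ← ENNReal.ofReal_one, ← ENNReal.ofReal_sub _ (by positivity)]
    congr 1
    field_simp
    ring

/-- The probability of a cylinder. -/
theorem letterMeasure_binaryPrefix_eq (hn : 1 ≤ n) (m : ℕ) (s : ℕ → Fin (n + 1)) :
    letterMeasure n {s' | binaryPrefix m s' = binaryPrefix m s} =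
      ENNReal.ofReal (Real.exp (∑ j ∈ Finset.range m, logProb (s j))) := by
  have h : {s' : ℕ → Fin (n + 1) | binaryPrefix m s' = binaryPrefix m s} =
      Set.pi (Finset.range m : Set ℕ) fun j => {i | i = 0 ↔ s j = 0} := by
    ext s'
    simp [binaryPrefix_eq_iff, Set.mem_pi]
  rw [h, Measure.infinitePi_pi _ fun _ _ => (toFinite _).measurableSet, Real.exp_sum,
    ENNReal.ofReal_prod_of_nonneg fun _ _ => (Real.exp_pos _).le]
  exact Finset.prod_congr rfl fun j _ => uniformOn_iff_eq hn (s j)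

theorem integral_logProb (hn : 1 ≤ n) :
    ∫ i, logProb i ∂(ProbabilityTheory.uniformOn (univ : Set (Fin (n + 1)))) =
      -Real.binEntropy (1 / (n + 1)) := by
  have hn' : (0 : ℝ) < n := by exact_mod_cast hn
  have h1 : ∀ i : Fin (n + 1),
      (ProbabilityTheory.uniformOn (univ : Set (Fin (n + 1)))).real {i} = 1 / (n + 1) := by
    intro i
    rw [Measure.real, ProbabilityTheory.uniformOn_univ, Measure.count_singleton, Fintype.card_fin,
      ENNReal.toReal_div, ENNReal.toReal_natCast, Nat.cast_succ, ENNReal.toReal_one]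
  have h2 : (1 : ℝ) - 1 / (n + 1) = n / (n + 1) := by
    field_simp
    ring
  rw [integral_fintype Integrable.of_finite, Fin.sum_univ_succ]
  simp only [h1, logProb, Fin.succ_ne_zero, if_true, if_false, smul_eq_mul, Finset.sum_const,
    Finset.card_univ, Fintype.card_fin, nsmul_eq_mul]
  rw [Real.binEntropy, h2, Real.log_inv, Real.log_inv]
  ring

/-- This is the strong law of large numbers; by `letterMeasure_binaryPrefix_eq` it says that typical
cylinders of level `m` have probability about `exp (-m h)`, with `h` the entropy of a digit. -/
theorem tendsto_sum_logProb (hn : 1 ≤ n) :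
    ∀ᵐ s ∂letterMeasure n, Filter.Tendsto
      (fun m : ℕ => (∑ j ∈ Finset.range m, logProb (s j)) / m) Filter.atTop
        (nhds (-Real.binEntropy (1 / (n + 1)))) := by
  have hm : Measurable (logProb : Fin (n + 1) → ℝ) := measurable_from_top
  have hev : ∀ j : ℕ, MeasurePreserving (fun s : ℕ → Fin (n + 1) => s j) (letterMeasure n)
      (ProbabilityTheory.uniformOn univ) := fun j => measurePreserving_eval_infinitePi _ j
  have h := ProbabilityTheory.strong_law_ae_real (μ := letterMeasure n)
    (fun (j : ℕ) (s : ℕ → Fin (n + 1)) => logProb (s j))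
    ((hev 0).integrable_comp_of_integrable (g := logProb) Integrable.of_finite)
    (fun i j hij => (ProbabilityTheory.iIndepFun_infinitePi
      (P := fun _ : ℕ => ProbabilityTheory.uniformOn (univ : Set (Fin (n + 1))))
      (X := fun _ => logProb) fun _ => hm).indepFun hij)
    (fun j => ⟨(hm.comp (measurable_pi_apply j)).aemeasurable,
      (hm.comp (measurable_pi_apply 0)).aemeasurable, by
        rw [← Function.comp_def logProb, ← Function.comp_def logProb,
          ← Measure.map_map hm (measurable_pi_apply j),
          ← Measure.map_map hm (measurable_pi_apply 0), (hev j).map_eq, (hev 0).map_eq]⟩)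
  have hint : ∫ s, logProb (s 0) ∂letterMeasure n = -Real.binEntropy (1 / (n + 1)) := by
    rw [← integral_logProb hn, ← (hev 0).map_eq,
      integral_map (hev 0).measurable.aemeasurable hm.aestronglyMeasurable]
  rwa [hint] at h

end Coding

/-! ### Lower and upper bounds for the dimension of the coordinate law. -/

section Dimension

variable {n : ℕ} (q : AffineBasis (Fin (n + 1)) ℝ (E n))

theorem nu_eq_map : nu q = (letterMeasure n).map fun s => q.coord 0 (address q s) := by
  rw [nu, stdMeasure, Measure.map_map (continuous_coord q 0).measurable
    (continuous_address q).measurable]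
  rfl

theorem isProbabilityMeasure_nu : IsProbabilityMeasure (nu q) := by
  have := isProbabilityMeasure_stdMeasure q
  exact Measure.isProbabilityMeasure_map (continuous_coord q 0).measurable.aemeasurable

theorem continuous_coord_address : Continuous fun s => q.coord 0 (address q s) :=
  (continuous_coord q 0).comp (continuous_address q)

theorem continuous_sum_logProb (m : ℕ) :
    Continuous fun s : ℕ → Fin (n + 1) => ∑ j ∈ Finset.range m, logProb (s j) :=
  continuous_finsetSum _ fun j _ => (continuous_of_discreteTopology (f := logProb)).comp
    (continuous_apply j)

/-- A sequence of letters whose cylinders of level `m ≥ N` all have probability at most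
`exp (-m h)` lies in a short interval with small probability. -/
theorem restrict_map_le (hn : 1 ≤ n) {h : ℝ} {N m : ℕ} (hNm : N ≤ m) {U : Set ℝ}
    (hU : ∀ u ∈ U, ∀ v ∈ U, |u - v| ≤ (1 / 2) ^ m) :
    ((letterMeasure n).restrict
      {s | ∀ m ≥ N, ∑ j ∈ Finset.range m, logProb (s j) ≤ -(m * h)}).map
        (fun s => q.coord 0 (address q s)) U ≤ 4 * ENNReal.ofReal (Real.exp (-(m * h))) := by
  set A := {s : ℕ → Fin (n + 1) | ∀ m ≥ N, ∑ j ∈ Finset.range m, logProb (s j) ≤ -(m * h)} with hA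
  have hxm := (continuous_coord_address q).measurable
  rcases U.eq_empty_or_nonempty with rfl | ⟨u, hu⟩
  · simp
  -- A coordinate `2⁻ᵐ (k + θ)` with `θ ∈ [0, 1]` lies within `2⁻ᵐ` of `u` only if `2ᵐ u - 2 ≤ k ≤
  -- 2ᵐ u + 1`, which leaves at most the four integers `a, …, a + 3`.
  set a := ⌈2 ^ m * u - 2⌉₊ with ha
  have hsub : U ⊆ Icc (u - (1 / 2) ^ m) (u + (1 / 2) ^ m) := fun v hv => by
    have := abs_le.1 (hU u hu v hv)
    exact ⟨by linarith, by linarith⟩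
  have hcov : (fun s => q.coord 0 (address q s)) ⁻¹' Icc (u - (1 / 2) ^ m) (u + (1 / 2) ^ m) ∩ A ⊆
      ⋃ k ∈ Finset.Icc a (a + 3), {s | binaryPrefix m s = k} ∩ A := by
    rintro s ⟨⟨h1, h2⟩, hs⟩
    refine mem_biUnion (x := binaryPrefix m s) ?_ ⟨rfl, hs⟩
    dsimp only at h1 h2
    have h3 := coord_nonneg q 0 (mem_range_self (f := address q) fun j => s (j + m))
    have h4 := coord_le_one q 0 (mem_range_self (f := address q) fun j => s (j + m))
    rw [coord_zero_address q m s] at h1 h2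
    have h5 : (2 : ℝ) ^ m * (1 / 2) ^ m = 1 := by
      rw [← mul_pow]
      norm_num
    have hp : (0 : ℝ) < 2 ^ m := by positivity
    have h6 := mul_le_mul_of_nonneg_left h1 hp.le
    have h7 := mul_le_mul_of_nonneg_left h2 hp.le
    rw [mul_sub, ← mul_assoc, h5] at h6
    rw [mul_add _ u, ← mul_assoc, h5] at h7
    simp only [Finset.coe_Icc, mem_Icc]
    constructor
    · rw [ha, Nat.ceil_le]
      linarith
    · have h8 := Nat.le_ceil (2 ^ m * u - 2)
      rw [← ha] at h8
      have h9 : (binaryPrefix m s : ℝ) ≤ ((a + 3 : ℕ) : ℝ) := by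
        push_cast
        linarith
      exact_mod_cast h9
  have hterm : ∀ k, letterMeasure n ({s | binaryPrefix m s = k} ∩ A) ≤
      ENNReal.ofReal (Real.exp (-(m * h))) := by
    intro k
    rcases ({s | binaryPrefix m s = k} ∩ A).eq_empty_or_nonempty with he | ⟨s, rfl, hs⟩
    · rw [he, measure_empty]
      exact zero_le
    -- A cylinder that meets `A` has the small probability prescribed by any sequence of `A` in it.
    · refine (measure_mono inter_subset_left).trans ?_
      rw [letterMeasure_binaryPrefix_eq hn m s]
      exact ENNReal.ofReal_le_ofReal (Real.exp_le_exp.2 (hs m hNm))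
  calc _ ≤ _ := measure_mono hsub
    _ = letterMeasure n ((fun s => q.coord 0 (address q s)) ⁻¹'
          Icc (u - (1 / 2) ^ m) (u + (1 / 2) ^ m) ∩ A) := by
        rw [Measure.map_apply hxm measurableSet_Icc, Measure.restrict_apply (hxm measurableSet_Icc)]
    _ ≤ ∑ k ∈ Finset.Icc a (a + 3), letterMeasure n ({s | binaryPrefix m s = k} ∩ A) :=
        (measure_mono hcov).trans (measure_biUnion_finset_le _ _)
    _ ≤ ∑ _k ∈ Finset.Icc a (a + 3), ENNReal.ofReal (Real.exp (-(m * h))) :=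
        Finset.sum_le_sum fun k _ => hterm k
    _ = _ := by
        rw [Finset.sum_const, Nat.card_Icc, nsmul_eq_mul, show a + 3 + 1 - a = 4 by omega]
        rfl

theorem measurableSet_forall_sum_logProb_le (N : ℕ) (h : ℝ) :
    MeasurableSet {s : ℕ → Fin (n + 1) |
      ∀ m ≥ N, ∑ j ∈ Finset.range m, logProb (s j) ≤ -(m * h)} := by
  have : IsClosed {s : ℕ → Fin (n + 1) |
      ∀ m ≥ N, ∑ j ∈ Finset.range m, logProb (s j) ≤ -(m * h)} := by
    simp only [ofPred_forall]
    exact isClosed_iInter fun m => isClosed_iInter fun _ =>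
      isClosed_le (continuous_sum_logProb m) continuous_const
  exact this.measurableSet

theorem exp_neg_mul_log_two (m : ℕ) (d : ℝ) :
    Real.exp (-(m * (d * Real.log 2))) = ((1 / 2 : ℝ) ^ m) ^ d := by
  rw [Real.rpow_def_of_pos (by positivity), Real.log_pow, one_div, Real.log_inv]
  congr 1
  ring

/-- A set of positive `ν`-measure has at least the entropy dimension. -/
theorem le_dimH_of_nu_pos (hn : 1 ≤ n) {d : NNReal} (hd0 : 0 < d)
    (hd : d * Real.log 2 < Real.binEntropy (1 / (n + 1))) {X : Set ℝ} (hX : MeasurableSet X)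
    (hpos : 0 < nu q X) : (d : ℝ≥0∞) ≤ dimH X := by
  -- Since `d log 2` is below the entropy, almost every sequence lies in some `A N`. Some `A N` thus
  -- keeps positive mass over `X`, and the restricted law `κ` satisfies a uniform Frostman bound.
  set A : ℕ → Set (ℕ → Fin (n + 1)) := fun N =>
    {s | ∀ m ≥ N, ∑ j ∈ Finset.range m, logProb (s j) ≤ -(m * (d * Real.log 2))} with hA
  have hAm : ∀ N, MeasurableSet (A N) := fun N => measurableSet_forall_sum_logProb_le N _
  have hxm := (continuous_coord_address q).measurable
  have hcov : letterMeasure n (⋃ N, A N)ᶜ = 0 := by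
    refine measure_mono_null ?_ (ae_iff.1 (tendsto_sum_logProb hn))
    intro s hs hlim
    refine hs (mem_iUnion.2 ?_)
    have hev := hlim.eventually_lt_const (neg_lt_neg hd)
    obtain ⟨N, hN⟩ := Filter.eventually_atTop.1 hev
    refine ⟨N + 1, fun m hm => ?_⟩
    have hm0 : (0 : ℝ) < m := by exact_mod_cast (Nat.succ_pos N).trans_le hm
    have := hN m ((Nat.le_succ N).trans hm)
    rw [div_lt_iff₀ hm0] at this
    linarith
  have hex : ∃ N, letterMeasure n ((fun s => q.coord 0 (address q s)) ⁻¹' X ∩ A N) ≠ 0 := by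
    by_contra! hall
    refine hpos.ne' ?_
    rw [nu_eq_map, Measure.map_apply hxm hX]
    refine measure_mono_null (t := (⋃ N, (fun s => q.coord 0 (address q s)) ⁻¹' X ∩ A N) ∪
      (⋃ N, A N)ᶜ) ?_ (measure_union_null (measure_iUnion_null hall) hcov)
    intro s hs
    by_cases h : s ∈ ⋃ N, A N
    · obtain ⟨N, hN⟩ := mem_iUnion.1 h
      exact Or.inl (mem_iUnion.2 ⟨N, hs, hN⟩)
    · exact Or.inr h
  obtain ⟨N, hN⟩ := hex
  set κ := ((letterMeasure n).restrict (A N)).map (fun s => q.coord 0 (address q s)) with hκ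
  have hκX : κ X ≠ 0 := by
    rwa [hκ, Measure.map_apply hxm hX, Measure.restrict_apply (hxm hX)]
  -- The factor `4` counts the cylinders, and `2 ^ d` pays for replacing a diameter in `(2⁻⁽ᵐ⁺¹⁾,
  -- 2⁻ᵐ]` by `2⁻ᵐ`.
  set C : ℝ≥0∞ := 4 * ENNReal.ofReal ((1 / 2 : ℝ) ^ (-(d : ℝ))) with hC
  have hhalf : (0 : ℝ) < (1 / 2 : ℝ) ^ (-(d : ℝ)) := Real.rpow_pos_of_pos (by norm_num) _
  have hC0 : C ≠ 0 := mul_ne_zero (by norm_num) (ENNReal.ofReal_pos.2 hhalf).ne'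
  have hCtop : C ≠ ∞ := ENNReal.mul_ne_top (by norm_num) ENNReal.ofReal_ne_top
  have hbound : ∀ U : Set ℝ, Metric.ediam U ≤ ENNReal.ofReal ((1 / 2) ^ N) →
      (C⁻¹ • κ) U ≤ Metric.ediam U ^ (d : ℝ) := by
    intro U hU
    have hUtop : Metric.ediam U ≠ ∞ := (hU.trans_lt ENNReal.ofReal_lt_top).ne
    have hm : ∀ m ≥ N, Metric.ediam U ≤ ENNReal.ofReal ((1 / 2) ^ m) →
        κ U ≤ 4 * ENNReal.ofReal (((1 / 2 : ℝ) ^ m) ^ (d : ℝ)) := by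
      intro m hNm hUm
      rw [← exp_neg_mul_log_two]
      refine restrict_map_le q hn hNm fun u hu v hv => ?_
      have := (Metric.edist_le_ediam_of_mem hu hv).trans hUm
      rwa [edist_dist, ENNReal.ofReal_le_ofReal_iff (by positivity), Real.dist_eq] at this
    rw [Measure.smul_apply, smul_eq_mul, ENNReal.inv_mul_le_iff hC0 hCtop]
    -- For diameter zero no single scale fits; letting `m` tend to infinity gives `κ U = 0`, because
    -- `d > 0`.
    rcases eq_or_ne (Metric.ediam U) 0 with h0 | h0
    · have hz : κ U ≤ 0 := by
        have hlim : Filter.Tendsto (fun m : ℕ => 4 * ENNReal.ofReal (((1 / 2 : ℝ) ^ m) ^ (d : ℝ)))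
            Filter.atTop (nhds (4 * ENNReal.ofReal ((0 : ℝ) ^ (d : ℝ)))) := by
          refine ENNReal.Tendsto.const_mul (ENNReal.tendsto_ofReal ?_) (Or.inr (by norm_num))
          exact (tendsto_pow_atTop_nhds_zero_of_lt_one (by norm_num) (by norm_num)).rpow_const
            (Or.inr d.2)
        rw [Real.zero_rpow (by exact_mod_cast hd0.ne'), ENNReal.ofReal_zero, mul_zero] at hlim
        refine ge_of_tendsto hlim ?_
        filter_upwards [Filter.eventually_ge_atTop N] with m hNm
        exact hm m hNm (by rw [h0]; exact zero_le)
      exact hz.trans zero_le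
    · set δ := (Metric.ediam U).toReal with hδ
      have hδU : Metric.ediam U = ENNReal.ofReal δ := (ENNReal.ofReal_toReal hUtop).symm
      have hδ0 : 0 < δ := ENNReal.toReal_pos h0 hUtop
      rw [hδU, ENNReal.ofReal_le_ofReal_iff (by positivity)] at hU
      obtain ⟨m, hm1, hm2⟩ := exists_nat_pow_near_of_lt_one hδ0
        (hU.trans (pow_le_one₀ (by norm_num) (by norm_num)))
        (show (0 : ℝ) < 1 / 2 by norm_num) (by norm_num)
      have hNm : N ≤ m := by
        by_contra! hlt
        have := pow_le_pow_of_le_one (show (0 : ℝ) ≤ 1 / 2 by norm_num) (by norm_num)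
          (Nat.succ_le_of_lt hlt)
        exact (hm1.trans_le hU).not_ge this
      refine (hm m hNm (by rw [hδU]; exact ENNReal.ofReal_le_ofReal hm2)).trans ?_
      rw [hδU, ENNReal.ofReal_rpow_of_pos hδ0, hC, mul_assoc, ← ENNReal.ofReal_mul hhalf.le]
      refine mul_le_mul_right (ENNReal.ofReal_le_ofReal ?_) _
      calc ((1 / 2 : ℝ) ^ m) ^ (d : ℝ)
          = (1 / 2 : ℝ) ^ (-(d : ℝ)) * ((1 / 2 : ℝ) ^ (m + 1)) ^ (d : ℝ) := by
            rw [pow_succ, Real.mul_rpow (by positivity) (by norm_num), mul_left_comm,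
              ← Real.rpow_add (by norm_num), neg_add_cancel, Real.rpow_zero, mul_one]
        _ ≤ _ := mul_le_mul_of_nonneg_left
            (Real.rpow_le_rpow (by positivity) hm1.le d.2) hhalf.le
  have hle := Measure.le_hausdorffMeasure (d : ℝ) (C⁻¹ • κ) (ENNReal.ofReal ((1 / 2) ^ N))
    (ENNReal.ofReal_pos.2 (by positivity)) hbound
  refine le_dimH_of_hausdorffMeasure_ne_zero fun h0 => ?_
  have h1 := hle X
  rw [h0, Measure.smul_apply, smul_eq_mul, nonpos_iff_eq_zero, mul_eq_zero] at h1
  exact h1.elim (ENNReal.inv_ne_zero.2 hCtop) hκX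

/-- The points whose cylinders of level `m ≥ N` have probability at least `2 ^ (-m d)` form a set
of dimension at most `d`. -/
theorem dimH_image_le (hn : 1 ≤ n) (d : NNReal) (N : ℕ) :
    dimH ((fun s => q.coord 0 (address q s)) ''
      {s : ℕ → Fin (n + 1) | ∀ m ≥ N,
        -(m * (d * Real.log 2)) ≤ ∑ j ∈ Finset.range m, logProb (s j)}) ≤ d := by
  classical
  set B := {s : ℕ → Fin (n + 1) | ∀ m ≥ N,
    -(m * (d * Real.log 2)) ≤ ∑ j ∈ Finset.range m, logProb (s j)} with hB
  have hlt : ∀ m : ℕ, ∀ s : ℕ → Fin (n + 1), binaryPrefix m s < 2 ^ m := by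
    intro m s
    induction m with
    | zero => simp [binaryPrefix]
    | succ m ih =>
      rw [binaryPrefix, pow_succ]
      split_ifs <;> omega
  set K : ℕ → Finset ℕ := fun m => (Finset.range (2 ^ m)).filter fun k =>
    ∃ s ∈ B, binaryPrefix m s = k with hK
  -- The cylinders are disjoint and each has probability at least `2⁻ᵐᵈ`, so there are at most `2ᵐᵈ`
  -- of them. Each corresponds to an interval of length `2⁻ᵐ`, so the `d`-dimensional Hausdorff
  -- measure is at most `1`.
  have hcard : ∀ m ≥ N, ((K m).card : ℝ≥0∞) *
      ENNReal.ofReal (((1 / 2 : ℝ) ^ m) ^ (d : ℝ)) ≤ 1 := by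
    intro m hm
    have hcont : ∀ k : ℕ, MeasurableSet {s : ℕ → Fin (n + 1) | binaryPrefix m s = k} := fun k =>
      measurable_binaryPrefix m (measurableSet_singleton k)
    calc ((K m).card : ℝ≥0∞) * ENNReal.ofReal (((1 / 2 : ℝ) ^ m) ^ (d : ℝ))
        = ∑ _k ∈ K m, ENNReal.ofReal (((1 / 2 : ℝ) ^ m) ^ (d : ℝ)) := by
          rw [Finset.sum_const, nsmul_eq_mul]
      _ ≤ ∑ k ∈ K m, letterMeasure n {s | binaryPrefix m s = k} := by
          refine Finset.sum_le_sum fun k hk => ?_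
          obtain ⟨s, hs, rfl⟩ := (Finset.mem_filter.1 hk).2
          rw [letterMeasure_binaryPrefix_eq hn m s, ← exp_neg_mul_log_two]
          exact ENNReal.ofReal_le_ofReal (Real.exp_le_exp.2 (hs m hm))
      _ ≤ letterMeasure n univ := sum_measure_le_measure_univ
          (fun k _ => (hcont k).nullMeasurableSet) fun k _ l _ hkl =>
            Disjoint.aedisjoint (Set.disjoint_left.2 fun s hs hs' => hkl (hs.symm.trans hs'))
      _ = 1 := measure_univ
  refine dimH_le_of_hausdorffMeasure_ne_top (ne_top_of_le_ne_top ENNReal.one_ne_top ?_)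
  have hr : Filter.Tendsto (fun m : ℕ => ENNReal.ofReal ((1 / 2 : ℝ) ^ m)) Filter.atTop
      (nhds 0) := by
    rw [← ENNReal.ofReal_zero]
    exact ENNReal.tendsto_ofReal (tendsto_pow_atTop_nhds_zero_of_lt_one (by norm_num)
      (by norm_num))
  have hdiam : ∀ m k : ℕ, Metric.ediam (Icc ((1 / 2 : ℝ) ^ m * k) ((1 / 2) ^ m * (k + 1))) =
      ENNReal.ofReal ((1 / 2 : ℝ) ^ m) := by
    intro m k
    rw [Real.ediam_Icc]
    congr 1
    ring
  refine (Measure.hausdorffMeasure_le_liminf_sum (d : ℝ) _ (l := Filter.atTop)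
    (ι := fun m => K m) _ hr (fun m k => Icc ((1 / 2 : ℝ) ^ m * (k : ℕ)) ((1 / 2) ^ m * ((k : ℕ) + 1)))
    (Filter.Eventually.of_forall fun m k => (hdiam m k).le)
    (Filter.Eventually.of_forall fun m => ?_)).trans ?_
  · rintro _ ⟨s, hs, rfl⟩
    refine mem_iUnion.2 ⟨⟨binaryPrefix m s, Finset.mem_filter.2
      ⟨Finset.mem_range.2 (hlt m s), s, hs, rfl⟩⟩, ?_⟩
    dsimp only
    have h3 := coord_nonneg q 0 (mem_range_self (f := address q) fun j => s (j + m))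
    have h4 := coord_le_one q 0 (mem_range_self (f := address q) fun j => s (j + m))
    rw [coord_zero_address q m s]
    constructor <;> refine mul_le_mul_of_nonneg_left ?_ (by positivity) <;> linarith
  · refine Filter.liminf_le_of_frequently_le' (Filter.Eventually.frequently ?_)
    filter_upwards [Filter.eventually_ge_atTop N] with m hm
    simp only [hdiam]
    rw [Finset.sum_const, nsmul_eq_mul, Finset.card_univ, Fintype.card_coe,
      ENNReal.ofReal_rpow_of_pos (by positivity)]
    exact hcard m hm

end Dimension

/-! ### The dimension of the coordinate law and its singularity. -/

section EntropyDimension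

variable {n : ℕ} (q : AffineBasis (Fin (n + 1)) ℝ (E n))

theorem binEntropy_div_log_two (hn : 1 ≤ n) :
    Real.binEntropy (1 / (n + 1)) / Real.log 2 =
      (((n : ℝ) + 1) * Real.log ((n : ℝ) + 1) - (n : ℝ) * Real.log (n : ℝ)) /
        (((n : ℝ) + 1) * Real.log 2) := by
  have hn' : (0 : ℝ) < n := by exact_mod_cast hn
  have h2 : (1 : ℝ) - 1 / (n + 1) = n / (n + 1) := by
    field_simp
    ring
  have hlog : Real.log 2 ≠ 0 := (Real.log_pos one_lt_two).ne'
  rw [Real.binEntropy, h2, one_div, inv_inv, inv_div, Real.log_div (by positivity) hn'.ne']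
  field_simp
  ring

theorem binEntropy_inv_pos (hn : 1 ≤ n) : 0 < Real.binEntropy (1 / ((n : ℝ) + 1)) := by
  have hn' : (0 : ℝ) < n := by exact_mod_cast hn
  refine Real.binEntropy_pos (by positivity) ?_
  rw [div_lt_one (by positivity)]
  linarith

/-- The measure `ν` is carried by a set of the entropy dimension. -/
theorem exists_nu_compl_eq_zero_and_dimH_le (hn : 1 ≤ n) :
    ∃ S : Set ℝ, MeasurableSet S ∧ nu q Sᶜ = 0 ∧
      dimH S ≤ ENNReal.ofReal (Real.binEntropy (1 / (n + 1)) / Real.log 2) := by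
  have hlog : 0 < Real.log 2 := Real.log_pos one_lt_two
  set h := Real.binEntropy (1 / ((n : ℝ) + 1)) with hh
  have hs0 : 0 ≤ h / Real.log 2 := div_nonneg (binEntropy_inv_pos hn).le hlog.le
  have hxm := (continuous_coord_address q).measurable
  -- The exponents `d j` decrease to entropy over `log 2`. For each of them almost every sequence
  -- lies in some `B j N`, so the intersection of the sets `S j` still has full measure.
  let d : ℕ → NNReal := fun j => Real.toNNReal (h / Real.log 2 + 1 / (j + 1))
  have hd : ∀ j, (d j : ℝ) = h / Real.log 2 + 1 / (j + 1) := fun j =>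
    Real.coe_toNNReal _ (by positivity)
  let B : ℕ → ℕ → Set (ℕ → Fin (n + 1)) := fun j N => {s | ∀ m ≥ N,
    -(m * (d j * Real.log 2)) ≤ ∑ i ∈ Finset.range m, logProb (s i)}
  let S : ℕ → Set ℝ := fun j => ⋃ N, (fun s => q.coord 0 (address q s)) '' B j N
  have hSm : ∀ j, MeasurableSet (S j) := by
    refine fun j => MeasurableSet.iUnion fun N => ?_
    have hcl : IsClosed (B j N) := by
      simp only [B, ofPred_forall]
      exact isClosed_iInter fun m => isClosed_iInter fun _ =>
        isClosed_le continuous_const (continuous_sum_logProb m)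
    exact (hcl.isCompact.image (continuous_coord_address q)).isClosed.measurableSet
  refine ⟨⋂ j, S j, MeasurableSet.iInter hSm, ?_, ?_⟩
  · rw [compl_iInter, measure_iUnion_null_iff]
    intro j
    rw [nu_eq_map, Measure.map_apply hxm (hSm j).compl]
    refine measure_mono_null ?_ (ae_iff.1 (tendsto_sum_logProb hn))
    intro s hs hlim
    refine hs (mem_iUnion.2 ?_)
    have hlt : h < d j * Real.log 2 := by
      rw [hd, add_mul, div_mul_cancel₀ _ hlog.ne']
      have : 0 < 1 / ((j : ℝ) + 1) * Real.log 2 := by positivity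
      linarith
    have hev := hlim.eventually_const_lt (neg_lt_neg hlt)
    obtain ⟨N, hN⟩ := Filter.eventually_atTop.1 hev
    refine ⟨N + 1, s, fun m hm => ?_, rfl⟩
    have hm0 : (0 : ℝ) < m := by exact_mod_cast (Nat.succ_pos N).trans_le hm
    have := hN m ((Nat.le_succ N).trans hm)
    rw [lt_div_iff₀ hm0] at this
    linarith
  · have hle : ∀ j : ℕ, dimH (⋂ j, S j) ≤ ENNReal.ofReal (h / Real.log 2 + 1 / (j + 1)) := by
      intro j
      refine (dimH_mono (iInter_subset S j)).trans ?_
      rw [dimH_iUnion]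
      exact iSup_le fun N => dimH_image_le q hn (d j) N
    have hlim : Filter.Tendsto (fun j : ℕ => ENNReal.ofReal (h / Real.log 2 + 1 / (j + 1)))
        Filter.atTop (nhds (ENNReal.ofReal (h / Real.log 2 + 0))) :=
      ENNReal.tendsto_ofReal (tendsto_const_nhds.add tendsto_one_div_add_atTop_nhds_zero_nat)
    rw [add_zero] at hlim
    exact ge_of_tendsto' hlim hle

theorem measureDim_nu (hn : 1 ≤ n) :
    measureDim (nu q) = ENNReal.ofReal (Real.binEntropy (1 / (n + 1)) / Real.log 2) := by
  have hlog : 0 < Real.log 2 := Real.log_pos one_lt_two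
  have := isProbabilityMeasure_nu q
  refine le_antisymm ?_ (le_iInf fun X => le_iInf fun hX => le_iInf fun hpos => ?_)
  · obtain ⟨S, hS, hS0, hdim⟩ := exists_nu_compl_eq_zero_and_dimH_le q hn
    refine (iInf_le_of_le S (iInf₂_le hS ?_)).trans hdim
    have h1 := prob_add_prob_compl (μ := nu q) hS
    rw [hS0, add_zero] at h1
    rw [h1]
    exact one_pos
  · refine ENNReal.le_of_forall_nnreal_lt fun d hd => ?_
    rcases eq_or_ne d 0 with rfl | hd0
    · exact zero_le
    refine le_dimH_of_nu_pos q hn (pos_iff_ne_zero.2 hd0) ?_ hX hpos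
    rw [← ENNReal.ofReal_coe_nnreal, ENNReal.ofReal_lt_ofReal_iff_of_nonneg d.coe_nonneg,
      lt_div_iff₀ hlog] at hd
    exact hd

/-- In dimension at least two, `ν` is carried by a Lebesgue null set. -/
theorem exists_nu_compl_eq_zero_and_hausdorffMeasure_eq_zero (hn : 2 ≤ n) :
    ∃ S : Set ℝ, nu q Sᶜ = 0 ∧ Measure.hausdorffMeasure 1 S = 0 := by
  have hlog : 0 < Real.log 2 := Real.log_pos one_lt_two
  obtain ⟨S, -, hS0, hdim⟩ := exists_nu_compl_eq_zero_and_dimH_le q (one_le_two.trans hn)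
  refine ⟨S, hS0, ?_⟩
  have h1 : dimH S < ((1 : NNReal) : ℝ≥0∞) := by
    refine hdim.trans_lt ?_
    rw [ENNReal.coe_one, ← ENNReal.ofReal_one, ENNReal.ofReal_lt_ofReal_iff one_pos,
      div_lt_one hlog, Real.binEntropy_lt_log_two]
    -- Binary entropy reaches `log 2` only at probability `1/2`, that is, for `n = 1`.
    intro h
    rw [one_div, inv_inj] at h
    have h3 : n + 1 = 2 := by exact_mod_cast h
    omega
  simpa using hausdorffMeasure_of_dimH_lt h1

theorem nu_compl_Icc : nu q (Icc 0 1)ᶜ = 0 := by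
  rw [nu_eq_map, Measure.map_apply (continuous_coord_address q).measurable
    measurableSet_Icc.compl]
  refine measure_mono_null (t := ∅) (fun s hs => hs ?_) measure_empty
  exact ⟨coord_nonneg q 0 (mem_range_self s), coord_le_one q 0 (mem_range_self s)⟩

end EntropyDimension

/-! ### Transfer of dimension and singularity to the geodesic. -/

section Transfer

variable {n : ℕ} {q : AffineBasis (Fin (n + 1)) ℝ (E n)}

/-- A measure on the line that is carried by `[0, 1]` keeps its dimension under a bi-Lipschitz
map. -/
theorem measureDim_map_of_bilipschitz {X : Type*} [MetricSpace X] [MeasurableSpace X]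
    [BorelSpace X] {μ : Measure ℝ} (hμ : μ (Icc 0 1)ᶜ = 0) {c : ℝ≥0∞} (hc : c ≠ 0) {h : ℝ → X}
    (hh : Continuous h) {K K' : NNReal} (hL : LipschitzOnWith K h (Icc 0 1))
    (hA : ∀ u ∈ Icc (0 : ℝ) 1, ∀ v ∈ Icc (0 : ℝ) 1, dist u v ≤ K' * dist (h u) (h v)) :
    measureDim (c • μ.map h) = measureDim μ := by
  have hanti : AntilipschitzWith K' fun u : Icc (0 : ℝ) 1 => h u :=
    AntilipschitzWith.of_le_mul_dist fun u v => hA u u.2 v v.2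
  have hinj : InjOn h (Icc 0 1) := fun u hu v hv huv => by
    have := hA u hu v hv
    rw [huv, dist_self, mul_zero] at this
    exact dist_le_zero.1 this
  have hinter : ∀ Y : Set ℝ, μ Y = μ (Y ∩ Icc 0 1) := fun Y =>
    (measure_inter_conull hμ).symm
  refine le_antisymm ?_ ?_
  · refine le_iInf fun Y => le_iInf fun hY => le_iInf fun hpos => ?_
    have hYm : MeasurableSet (Y ∩ Icc 0 1) := hY.inter measurableSet_Icc
    -- A continuous injective image of a Borel set is Borel, by the Lusin–Souslin theorem.
    have him : MeasurableSet (h '' (Y ∩ Icc 0 1)) :=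
      hYm.image_of_continuousOn_injOn hh.continuousOn (hinj.mono inter_subset_right)
    refine iInf_le_of_le (h '' (Y ∩ Icc 0 1)) (iInf₂_le_of_le him ?_ ?_)
    · rw [Measure.smul_apply, smul_eq_mul, Measure.map_apply hh.measurable him]
      rw [hinter] at hpos
      exact ENNReal.mul_pos hc (hpos.trans_le (measure_mono (subset_preimage_image _ _))).ne'
    · exact (hL.mono inter_subset_right).dimH_image_le.trans (dimH_mono inter_subset_left)
  · refine le_iInf fun Y => le_iInf fun hY => le_iInf fun hpos => ?_
    have hpre : MeasurableSet (h ⁻¹' Y ∩ Icc 0 1) := (hh.measurable hY).inter measurableSet_Icc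
    refine iInf_le_of_le (h ⁻¹' Y ∩ Icc 0 1) (iInf₂_le_of_le hpre ?_ ?_)
    · rw [← hinter, ← Measure.map_apply hh.measurable hY]
      rw [Measure.smul_apply, smul_eq_mul] at hpos
      exact pos_iff_ne_zero.2 (right_ne_zero_of_mul hpos.ne')
    · have himg : h ⁻¹' Y ∩ Icc 0 1 =
          (Subtype.val : Icc (0 : ℝ) 1 → ℝ) '' ((fun u : Icc (0 : ℝ) 1 => h u) ⁻¹' Y) := by
        ext u
        constructor
        · rintro ⟨h1, h2⟩
          exact ⟨⟨u, h2⟩, h1, rfl⟩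
        · rintro ⟨v, hv, rfl⟩
          exact ⟨hv, v.2⟩
      rw [himg, isometry_subtype_coe.dimH_image]
      exact hanti.dimH_preimage_le Y

theorem IsGeodesic.gdist_eq_abs (hq : IsUnitSimplex q) {x y : E n} (hxy : x ≠ y)
    {g : Path x y} (hg : IsGeodesic q g) {s t : ℝ} (hs : s ∈ I) (ht : t ∈ I) :
    gdist q (g.extend s) (g.extend t) = |s - t| * gdist q x y := by
  rw [Path.extend_apply g hs, Path.extend_apply g ht]
  rcases le_total s t with h | h
  · rw [hg.gdist_eq_mul hq hxy (show (⟨s, hs⟩ : I) ≤ ⟨t, ht⟩ from h), abs_sub_comm,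
      abs_of_nonneg (sub_nonneg.2 h)]
  · rw [gdist_comm, hg.gdist_eq_mul hq hxy (show (⟨t, ht⟩ : I) ≤ ⟨s, hs⟩ from h),
      abs_of_nonneg (sub_nonneg.2 h)]

/-- Outside the unit interval `γ.extend` is constant, so distances along `γ` need this. The extreme
case `u = 0` is realized by a vertex of the cell other than the entry vertex. -/
theorem mem_unitInterval_of_mem_Icc (hq : IsUnitSimplex q) {w : List (Fin (n + 1))}
    {i : Fin (n + 1)} {b : E n} (hb : b ∈ gasket q) (hbA : b ∉ cell q w)
    {γ : Path (cellVertex q w i) b}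
    (huniq : ∀ γ' : Path (cellVertex q w i) b, IsGeodesic q γ' → γ' = γ)
    (hpass : ∀ a ∈ cell q w, ∀ g : Path a b, IsGeodesic q g → cellVertex q w i ∈ range g)
    {t : I} (ht : finalEntryTime q γ (cell q w) {b} ≤ t) {u : ℝ} (hu : u ∈ Icc (0 : ℝ) 1) :
    t - (1 - t) * (1 / 2) ^ w.length / gdist q (cellVertex q w i) b * (1 - u) ∈ I := by
  have : Nontrivial (Fin (n + 1)) :=
    Fin.nontrivial_iff_two_le.2 (by have := one_le_of_notMem_cell hbA; omega)
  obtain ⟨j, hj⟩ := exists_ne i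
  obtain ⟨r, -, hr⟩ := exists_Z_eq hq hb hbA huniq hpass ht (vertex_mem_gasket q j)
  rw [AffineBasis.coord_apply_ne _ hj.symm, sub_zero, mul_one] at hr
  have hlam0 : 0 ≤ (1 - (t : ℝ)) * (1 / 2) ^ w.length / gdist q (cellVertex q w i) b :=
    div_nonneg (mul_nonneg (sub_nonneg.2 t.2.2) (by positivity)) (gdist_nonneg _ _)
  have hr0 := r.2.1
  rw [hr] at hr0
  constructor <;> nlinarith [hu.1, hu.2, t.2.2]

/-- The speed of `γ` is the distance from the entry vertex to `b`; it cancels the denominator in the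
slope of `H`. -/
theorem gdist_H (hq : IsUnitSimplex q) {w : List (Fin (n + 1))} {i : Fin (n + 1)}
    {b : E n} (hb : b ∈ gasket q) (hbA : b ∉ cell q w) {γ : Path (cellVertex q w i) b}
    (hγ : IsGeodesic q γ)
    (huniq : ∀ γ' : Path (cellVertex q w i) b, IsGeodesic q γ' → γ' = γ)
    (hpass : ∀ a ∈ cell q w, ∀ g : Path a b, IsGeodesic q g → cellVertex q w i ∈ range g)
    {t : I} (ht : finalEntryTime q γ (cell q w) {b} ≤ t) {u v : ℝ} (hu : u ∈ Icc (0 : ℝ) 1)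
    (hv : v ∈ Icc (0 : ℝ) 1) :
    gdist q (H q γ t (cell q w) b u) (H q γ t (cell q w) b v) =
      (1 - t) * (1 / 2) ^ w.length * dist u v := by
  have hvb := cellVertex_ne_of_notMem_cell i hbA
  have hL := gdist_pos hq (cell_subset_gasket q w (cellVertex_mem_cell q w i)) hb hvb
  rw [H_eq hq hb hbA hγ huniq hpass ht, H_eq hq hb hbA hγ huniq hpass ht,
    hγ.gdist_eq_abs hq hvb (mem_unitInterval_of_mem_Icc hq hb hbA huniq hpass ht hu)
      (mem_unitInterval_of_mem_Icc hq hb hbA huniq hpass ht hv), sub_sub_sub_cancel_left,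
    ← mul_sub, sub_sub_sub_cancel_left, abs_mul, abs_div, abs_of_pos hL, Real.dist_eq,
    abs_of_nonneg (mul_nonneg (sub_nonneg.2 t.2.2) (by positivity))]
  field_simp

theorem H_mem_gasket {x y : E n} {γ : Path x y} (hγ : range γ ⊆ gasket q) (t : I)
    (A : Set (E n)) (b : E n) (u : ℝ) : H q γ t A b u ∈ gasket q :=
  hγ (γ.extend_range.subset (mem_range_self _))

theorem dist_H_le (hq : IsUnitSimplex q) {w : List (Fin (n + 1))} {i : Fin (n + 1)}
    {b : E n} (hb : b ∈ gasket q) (hbA : b ∉ cell q w) {γ : Path (cellVertex q w i) b}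
    (hγ : IsGeodesic q γ)
    (huniq : ∀ γ' : Path (cellVertex q w i) b, IsGeodesic q γ' → γ' = γ)
    (hpass : ∀ a ∈ cell q w, ∀ g : Path a b, IsGeodesic q g → cellVertex q w i ∈ range g)
    {t : I} (ht : finalEntryTime q γ (cell q w) {b} ≤ t) {u v : ℝ} (hu : u ∈ Icc (0 : ℝ) 1)
    (hv : v ∈ Icc (0 : ℝ) 1) :
    dist (H q γ t (cell q w) b u) (H q γ t (cell q w) b v) ≤
      (1 - t) * (1 / 2) ^ w.length * dist u v :=
  (dist_le_gdist hq (H_mem_gasket hγ.subset _ _ _ _) (H_mem_gasket hγ.subset _ _ _ _)).trans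
    (gdist_H hq hb hbA hγ huniq hpass ht hu hv).le

theorem lipschitzOnWith_H (hq : IsUnitSimplex q) {w : List (Fin (n + 1))} {i : Fin (n + 1)}
    {b : E n} (hb : b ∈ gasket q) (hbA : b ∉ cell q w) {γ : Path (cellVertex q w i) b}
    (hγ : IsGeodesic q γ)
    (huniq : ∀ γ' : Path (cellVertex q w i) b, IsGeodesic q γ' → γ' = γ)
    (hpass : ∀ a ∈ cell q w, ∀ g : Path a b, IsGeodesic q g → cellVertex q w i ∈ range g)
    {t : I} (ht : finalEntryTime q γ (cell q w) {b} ≤ t) :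
    LipschitzOnWith 1 (H q γ t (cell q w) b) (Icc 0 1) := by
  refine LipschitzOnWith.of_dist_le_mul fun u hu v hv => ?_
  refine (dist_H_le hq hb hbA hγ huniq hpass ht hu hv).trans
    (mul_le_mul_of_nonneg_right ?_ dist_nonneg)
  exact mul_le_one₀ (by linarith [t.2.1]) (by positivity)
    (pow_le_one₀ (by norm_num) (by norm_num))

/-- The measure `η_t` is singular with respect to arc length. -/
theorem eta_mutuallySingular (hq : IsUnitSimplex q) {w : List (Fin (n + 1))} {i : Fin (n + 1)}
    {b : E n} (hb : b ∈ gasket q) (hbA : b ∉ cell q w) {γ : Path (cellVertex q w i) b}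
    (hγ : IsGeodesic q γ)
    (huniq : ∀ γ' : Path (cellVertex q w i) b, IsGeodesic q γ' → γ' = γ)
    (hpass : ∀ a ∈ cell q w, ∀ g : Path a b, IsGeodesic q g → cellVertex q w i ∈ range g)
    {t : I} (ht : finalEntryTime q γ (cell q w) {b} ≤ t) (hn : 2 ≤ n) :
    (eta q γ t (cell q w) b).MutuallySingular (arcLength γ) := by
  obtain ⟨S, hS0, hS1⟩ := exists_nu_compl_eq_zero_and_hausdorffMeasure_eq_zero q hn
  set h := H q γ t (cell q w) b with hh
  have hhm : Measurable h := (continuous_H γ t _ b).measurable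
  have hT : arcLength γ (h '' (S ∩ Icc 0 1)) = 0 := by
    have h1 := ((lipschitzOnWith_H hq hb hbA hγ huniq hpass ht).mono
      (inter_subset_right (s := S))).hausdorffMeasure_image_le (d := 1) zero_le_one
    rw [measure_mono_null inter_subset_left hS1, mul_zero, nonpos_iff_eq_zero] at h1
    exact Measure.absolutelyContinuous_of_le Measure.restrict_le_self h1
  -- The image of the null carrier need not be measurable, so it is replaced by a measurable hull of
  -- the same arc length, namely zero.
  have hTm := measurableSet_toMeasurable (arcLength γ) (h '' (S ∩ Icc 0 1))
  refine ⟨(toMeasurable (arcLength γ) (h '' (S ∩ Icc 0 1)))ᶜ, hTm.compl, ?_, ?_⟩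
  · rw [eta_eq hq hb hbA hγ huniq hpass ht, Measure.smul_apply, Measure.map_apply hhm hTm.compl]
    refine smul_eq_zero_of_right _ (measure_mono_null ?_
      (measure_union_null hS0 (nu_compl_Icc q)))
    intro u hu
    by_contra hcon
    rw [← compl_inter, mem_compl_iff, not_not] at hcon
    exact hu (subset_toMeasurable _ _ (mem_image_of_mem h hcon))
  · rw [compl_compl, measure_toMeasurable, hT]

/-- For `t < 1` the scaling factor of `H` in the intrinsic metric is positive, and comparison with
the Euclidean metric makes `H` bi-Lipschitz on `[0, 1]`. -/
theorem measureDim_eta (hq : IsUnitSimplex q) {w : List (Fin (n + 1))} {i : Fin (n + 1)}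
    {b : E n} (hb : b ∈ gasket q) (hbA : b ∉ cell q w) {γ : Path (cellVertex q w i) b}
    (hγ : IsGeodesic q γ)
    (huniq : ∀ γ' : Path (cellVertex q w i) b, IsGeodesic q γ' → γ' = γ)
    (hpass : ∀ a ∈ cell q w, ∀ g : Path a b, IsGeodesic q g → cellVertex q w i ∈ range g)
    {t : I} (ht : finalEntryTime q γ (cell q w) {b} ≤ t) (ht1 : t < 1) :
    measureDim (eta q γ t (cell q w) b) = measureDim (nu q) := by
  obtain ⟨C, hC⟩ := exists_gdist_le_mul_dist hq
  have ht1' : (0 : ℝ) < 1 - t := sub_pos.2 ht1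
  have hK : (0 : ℝ) < (1 - t) * (1 / 2) ^ w.length := by positivity
  rw [eta_eq hq hb hbA hγ huniq hpass ht]
  refine measureDim_map_of_bilipschitz (nu_compl_Icc q)
    (pow_ne_zero _ (ENNReal.inv_ne_zero.2 (by finiteness))) (continuous_H γ t _ b)
    (lipschitzOnWith_H hq hb hbA hγ huniq hpass ht)
    (K' := C / Real.toNNReal ((1 - t) * (1 / 2) ^ w.length)) fun u hu v hv => ?_
  have h1 := hC _ (H_mem_gasket hγ.subset t (cell q w) b u) _
    (H_mem_gasket hγ.subset t (cell q w) b v)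
  rw [gdist_H hq hb hbA hγ huniq hpass ht hu hv] at h1
  rw [NNReal.coe_div, Real.coe_toNNReal _ hK.le, div_mul_eq_mul_div, le_div_iff₀' hK]
  exact h1

end Transfer

end

end Gasket

theorem mainTheorem8 (n : ℕ) (q : AffineBasis (Fin (n + 1)) ℝ (Gasket.E n))
    (hq : Gasket.IsUnitSimplex q)
    (w : List (Fin (n + 1))) (i : Fin (n + 1))
    (b : Gasket.E n) (hb : b ∈ Gasket.gasket q) (hbA : b ∉ Gasket.cell q w)
    (γ : Path (Gasket.cellVertex q w i) b) (hγ : Gasket.IsGeodesic q γ)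
    (huniq : ∀ γ' : Path (Gasket.cellVertex q w i) b, Gasket.IsGeodesic q γ' → γ' = γ)
    (hpass : ∀ a ∈ Gasket.cell q w, ∀ g : Path a b, Gasket.IsGeodesic q g →
      Gasket.cellVertex q w i ∈ Set.range g)
    (t : unitInterval) (ht : Gasket.finalEntryTime q γ (Gasket.cell q w) {b} ≤ (t : ℝ)) :
    Gasket.eta q γ t (Gasket.cell q w) b =
        (((n : ℝ≥0∞) + 1)⁻¹ ^ w.length) •
          (Gasket.nu q).map (Gasket.H q γ t (Gasket.cell q w) b) ∧
      (2 ≤ n → (Gasket.eta q γ t (Gasket.cell q w) b).MutuallySingular (Gasket.arcLength γ)) ∧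
      (t < 1 →
        Gasket.measureDim (Gasket.eta q γ t (Gasket.cell q w) b) =
            Gasket.measureDim (Gasket.nu q) ∧
          Gasket.measureDim (Gasket.eta q γ t (Gasket.cell q w) b) =
            ENNReal.ofReal ((((n : ℝ) + 1) * Real.log ((n : ℝ) + 1) - (n : ℝ) * Real.log (n : ℝ)) /
              (((n : ℝ) + 1) * Real.log 2))) := by
  have hn := Gasket.one_le_of_notMem_cell hbA
  refine ⟨Gasket.eta_eq hq hb hbA hγ huniq hpass ht,
    Gasket.eta_mutuallySingular hq hb hbA hγ huniq hpass ht, fun ht1 => ?_⟩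
  have h := Gasket.measureDim_eta hq hb hbA hγ huniq hpass ht ht1
  refine ⟨h, ?_⟩
  rw [h, Gasket.measureDim_nu q hn, Gasket.binEntropy_div_log_two hn]
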